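/- Let $n\ge 0$ and let $u$, $p_{ij}$, $q_{ij}$ ($1\le i,j\le n$) be complex numbers with $u^2\neq -1$, $p_{ij}q_{ij}=u^2$ for $i<j$, $p_{ij}p_{ji}=q_{ij}q_{ji}=1$ and $p_{ii}=q_{ii}=1$. Let $M_{p,u}(n)$ be the unital associative $\mathbb{C}$-algebra generated by $t_{ij}$, $1\le i,j\le n$, with the relations, for all $i<j$ and $k<l$ (and in the first line for all $i$, in the second for all $k$), $$t_{ik}t_{il}=q_{kl}\,t_{il}t_{ik},$$ $$t_{ik}t_{jk}=p_{ij}\,t_{jk}t_{ik},$$ $$q_{kl}\,t_{il}t_{jk}=p_{ij}\,t_{jk}t_{il},$$ $$q_{kl}^{-1}t_{ik}t_{jl}-q_{ij}^{-1}t_{jl}t_{ik}=(1-u^{-2})\,t_{il}t_{jk}.$$ Put $T=(t_{ij})$. For $\sigma\in S_n$ let $$(-q)_\sigma=(-1)^{l(\sigma)}\prod_{i<j,\ \sigma_i>\sigma_j}q_{\sigma_j\sigma_i},\qquad l(\sigma)=|\{(i,j): i<j,\ \sigma_i>\sigma_j\}|,$$ and let $\det_q(T)=\sum_{\sigma\in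 S_n}(-q)_\sigma\, t_{1\sigma_1}\cdots t_{n\sigma_n}$. For a square matrix $X$ over a ring, with rows indexed by $I$ and columns by $J$, and for $i\in I$, $j\in J$, the quasideterminant $|X|_{ij}$ is defined when $X$ has a two-sided inverse $Y=X^{-1}=(y_{ba})_{b\in J,\,a\in I}$ and $y_{ji}$ is invertible, and then $|X|_{ij}=y_{ji}^{-1}$. Let $X^{i_1\cdots i_r,\,j_1\cdots j_r}$ denote $X$ with the rows $i_1,\dots,i_r$ and the columns $j_1,\dots,j_r$ deleted, the remaining rows and columns keeping their labels. Then $M_{p,u}(n)$ is a (left) Ore domain, so that its ring of fractions exists and is a division ring; and the following holds in this ring of fractions. (1) The quasideterminants $|T|_{11},\ |T^{1,1}|_{22},\ |T^{12,12}|_{33},\ \dots$, the last of which is $t_{nn}$, are all defined, they commute with each other, and $$\det\nolimits_q(T)=|T|_{11}\,|T^{1,1}|_{22}\,|T^{12,12}|_{33}\cdots t_{nn}.$$ (2) For all $\sigma,\tau\in S_n$ the quasideterminants $|T|_{\sigma_1\tau_1},\ |T^{\sigma_1,\tau_1}|_{\sigma_2\tau_2},\ |T^{\sigma_1\sigma_2,\,\tau_1\tau_2}|_{\sigma_3\tau_3},\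 \dots$, the last of which is $t_{\sigma_n\tau_n}$, are all defined, and $$\det\nolimits_q(T)=\frac{(-q)_\tau}{(-q)_\sigma}\,|T|_{\sigma_1\tau_1}\,|T^{\sigma_1,\tau_1}|_{\sigma_2\tau_2}\,|T^{\sigma_1\sigma_2,\,\tau_1\tau_2}|_{\sigma_3\tau_3}\cdots t_{\sigma_n\tau_n}.$$ (For $n=0$ the empty products are $1$.) -/

import Mathlib

open scoped nonZeroDivisors

namespace QuantumMatrix

/-- The parameters `p i j`, `q i j`, `u` of the multiparameter quantum matrix algebra. -/
structure IsParameter {n : ℕ} (p q : Fin n → Fin n → ℂ) (u : ℂ) : Prop where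
  mul_eq : ∀ i j, i < j → p i j * q i j = u ^ 2
  sq_ne : u ^ 2 ≠ -1
  p_mul_symm : ∀ i j, p i j * p j i = 1
  q_mul_symm : ∀ i j, q i j * q j i = 1
  p_diag : ∀ i, p i i = 1
  q_diag : ∀ i, q i i = 1

/-- The free generator attached to the position `(i, j)`. -/
noncomputable abbrev gen {n : ℕ} (i j : Fin n) : FreeAlgebra ℂ (Fin n × Fin n) :=
  FreeAlgebra.ι ℂ (i, j)

/-- The quadratic relations (the entries of `R T₁ T₂ = T₂ T₁ R`) between the generators. -/
inductive Rel {n : ℕ} (p q : Fin n → Fin n → ℂ) (u : ℂ) :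
    FreeAlgebra ℂ (Fin n × Fin n) → FreeAlgebra ℂ (Fin n × Fin n) → Prop
  | row (i k l : Fin n) (hkl : k < l) :
      Rel p q u (gen i k * gen i l) (q k l • (gen i l * gen i k))
  | col (i j k : Fin n) (hij : i < j) :
      Rel p q u (gen i k * gen j k) (p i j • (gen j k * gen i k))
  | anti (i j k l : Fin n) (hij : i < j) (hkl : k < l) :
      Rel p q u (q k l • (gen i l * gen j k)) (p i j • (gen j k * gen i l))
  | cross (i j k l : Fin n) (hij : i < j) (hkl : k < l) :
      Rel p q u
        ((q k l)⁻¹ • (gen i k * gen j l) - (q i j)⁻¹ • (gen j l * gen i k))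
        ((1 - (u ^ 2)⁻¹) • (gen i l * gen j k))

/-- The multiparameter quantum matrix algebra `M_{p,u}(n)`: the unital associative `ℂ`-algebra
presented by the generators `t i j` and the relations `Rel`. -/
def QMat {n : ℕ} (p q : Fin n → Fin n → ℂ) (u : ℂ) : Type :=
  RingQuot (Rel p q u)

noncomputable instance {n : ℕ} (p q : Fin n → Fin n → ℂ) (u : ℂ) : Ring (QMat p q u) :=
  inferInstanceAs (Ring (RingQuot (Rel p q u)))

noncomputable instance {n : ℕ} (p q : Fin n → Fin n → ℂ) (u : ℂ) : Algebra ℂ (QMat p q u) :=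
  inferInstanceAs (Algebra ℂ (RingQuot (Rel p q u)))

/-- The quotient map from the free algebra. -/
noncomputable def mk {n : ℕ} (p q : Fin n → Fin n → ℂ) (u : ℂ) :
    FreeAlgebra ℂ (Fin n × Fin n) →ₐ[ℂ] QMat p q u :=
  RingQuot.mkAlgHom ℂ (Rel p q u)

/-- The generating matrix `T = (t i j)`. -/
noncomputable def genMatrix {n : ℕ} (p q : Fin n → Fin n → ℂ) (u : ℂ) :
    Matrix (Fin n) (Fin n) (QMat p q u) :=
  Matrix.of fun i j => mk p q u (gen i j)

/-- The inversions of `σ`: pairs `i < j` with `σ j < σ i`. -/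
def inversions {n : ℕ} (σ : Equiv.Perm (Fin n)) : Finset (Fin n × Fin n) :=
  Finset.univ.filter fun x => x.1 < x.2 ∧ σ x.2 < σ x.1

/-- The `q`-inversion `(-q)_σ`. -/
noncomputable def qInv {n : ℕ} (q : Fin n → Fin n → ℂ) (σ : Equiv.Perm (Fin n)) : ℂ :=
  (-1) ^ (inversions σ).card * ∏ x ∈ inversions σ, q (σ x.2) (σ x.1)

/-- The quantum determinant `∑ σ, (-q)_σ t_{1,σ 1} ⋯ t_{n,σ n}` (factors in this order). -/
noncomputable def qdet {n : ℕ} (p q : Fin n → Fin n → ℂ) (u : ℂ) : QMat p q u :=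
  ∑ σ : Equiv.Perm (Fin n),
    qInv q σ • (List.ofFn fun i => genMatrix p q u i (σ i)).prod

/-- `HasQuasidet X i j d`: the matrix `X` over a (noncommutative) ring has a two-sided inverse `Y`,
the entry `Y j i` is invertible, and `d = (Y j i)⁻¹`; that is, the `(i, j)`-th quasideterminant
of `X` is defined and equal to `d`. -/
def HasQuasidet {K I J : Type*} [Ring K] [Fintype I] [Fintype J] [DecidableEq I] [DecidableEq J]
    (X : Matrix I J K) (i : I) (j : J) (d : K) : Prop :=
  ∃ Y : Matrix J I K, X * Y = 1 ∧ Y * X = 1 ∧ d * Y j i = 1 ∧ Y j i * d = 1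

/-- The quasideterminant is unique. -/
theorem HasQuasidet.unique {K I J : Type*} [Ring K] [Fintype I] [Fintype J] [DecidableEq I]
    [DecidableEq J] {X : Matrix I J K} {i : I} {j : J} {d e : K}
    (hd : HasQuasidet X i j d) (he : HasQuasidet X i j e) : d = e := by
  obtain ⟨Y, _, hY, hd, _⟩ := hd
  obtain ⟨Z, hZ, _, _, he⟩ := he
  have hYZ : Y = Z := by
    calc Y = Y * (X * Z) := by rw [hZ, Matrix.mul_one]
      _ = Z := by rw [← Matrix.mul_assoc, hY, Matrix.one_mul]
  subst hYZ
  calc d = d * (Y j i * e) := by rw [he, mul_one]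
    _ = e := by rw [← mul_assoc, hd, one_mul]

/-- The indices that remain after deleting `σ m` for all `m < k`; they include `σ k`. -/
abbrev Remaining {n : ℕ} (σ : Equiv.Perm (Fin n)) (k : Fin n) : Type :=
  {i : Fin n // ∀ m, m < k → i ≠ σ m}

/-- The index `σ k` among those remaining after the deletion of `σ m` for all `m < k`. -/
def pivot {n : ℕ} (σ : Equiv.Perm (Fin n)) (k : Fin n) : Remaining σ k :=
  ⟨σ k, fun _ hm h => hm.ne' (σ.injective h)⟩

/-- The submatrix of `X` obtained by deleting the rows `σ m` and the columns `τ m`, `m < k`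
(with the original labels of rows and columns). -/
def deleted {K : Type*} {n : ℕ} (X : Matrix (Fin n) (Fin n) K) (σ τ : Equiv.Perm (Fin n))
    (k : Fin n) : Matrix (Remaining σ k) (Remaining τ k) K :=
  X.submatrix Subtype.val Subtype.val

/-- The canonical map from `M_{p,u}(n)` to its ring of fractions. -/
noncomputable abbrev toFrac {n : ℕ} (p q : Fin n → Fin n → ℂ) (u : ℂ)
    [OreLocalization.OreSet (QMat p q u)⁰] :
    QMat p q u →+* OreLocalization (QMat p q u)⁰ (QMat p q u) :=
  OreLocalization.numeratorRingHom

end QuantumMatrix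

set_option linter.unusedSectionVars false

/-! Quantum minors, defined by expansion along the first row, change by a nonzero scalar when two
rows are exchanged and vanish when a row repeats; both facts reduce to `2 × 2` minors
(`minor_cons_cons`), where they are the defining relations (`isAlternating_genMatrix`). Hence the
cofactor matrix inverts a submatrix of `T` in the ring of fractions, and each quasideterminant is a
scalar times a quotient of two quantum minors (`hasQuasidet_of_minor`). Along a flag of deleted rows
and columns the quotients telescope to `det_q`, up to the inversion scalars (`prod_tailMinor`).

This requires that the algebra is an Ore domain, that the minors are nonzero, and that the principal
minors commute. All three rest on a representation on a quantum torus, valid for every admissible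
choice of parameters. Start from a matrix of `q`-commuting units and adjoin its rows one by one;
adjoining a row `ξ` multiplies the rows above it by the triangular matrix with entries `(ξ k)⁻¹ * ξ
j`, `j ≤ k`. The result satisfies the defining relations (`stage_relations`), and each generator
acts with its own unit as leading term (`stage_hasLead`).

Consequently ordered monomials have distinct leading exponents. They also span the algebra
(`span_range_pbw`), so the representation is faithful and every nonzero element has a leading term;
leading exponents add under multiplication, so there are no zero divisors. The polynomially many
ordered monomials of bounded length force the Ore condition (`exists_left_common_multiple`). A minor
is nonzero because the terms of its expansion have different leading exponents.

Finally, Gaussian elimination in the representation (`exists_stage_elimination`) turns a principal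
minor into a product of diagonal units. These commute with each other, and faithfulness carries this
back to the algebra (`commute_principalMinor`). -/

namespace QuantumMatrix

/-! ### Quantum minors and their alternating property in the rows. -/

section Minor

variable {ι κ A : Type*} [LinearOrder κ] [Ring A] [Algebra ℂ A]

/-- The coefficient `∏ (-b k j)`, over the `k < j` in `C`, of the column `j` in an expansion along
the first row of a quantum minor with columns `C`. -/
noncomputable def colCoeff (b : κ → κ → ℂ) (C : Finset κ) (j : κ) : ℂ :=
  ∏ k ∈ C with k < j, -b k j

theorem colCoeff_ne_zero {b : κ → κ → ℂ} (hb : ∀ k l, b k l ≠ 0) (C : Finset κ) (j : κ) :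
    colCoeff b C j ≠ 0 :=
  Finset.prod_ne_zero_iff.2 fun k _ => neg_ne_zero.2 (hb k j)

theorem colCoeff_erase_of_le (b : κ → κ → ℂ) (C : Finset κ) {j l : κ} (h : j ≤ l) :
    colCoeff b (C.erase l) j = colCoeff b C j := by
  unfold colCoeff
  congr 1
  ext k
  simp only [Finset.mem_filter, Finset.mem_erase]
  constructor
  · rintro ⟨⟨_, h1⟩, h2⟩
    exact ⟨h1, h2⟩
  · rintro ⟨h1, h2⟩
    exact ⟨⟨(h2.trans_le h).ne, h1⟩, h2⟩

theorem colCoeff_eq_mul_erase (b : κ → κ → ℂ) {C : Finset κ} {k l : κ} (hk : k ∈ C) (h : k < l) :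
    colCoeff b C l = -b k l * colCoeff b (C.erase k) l := by
  unfold colCoeff
  rw [← Finset.mul_prod_erase (a := k) _ _ (by simp [hk, h]), Finset.filter_erase]

/-- The quantum minor of `x` with the list of rows `r` and the set of columns `C`, defined by
expansion along the first row. -/
noncomputable def minor (b : κ → κ → ℂ) (x : ι → κ → A) : List ι → Finset κ → A
  | [], _ => 1
  | i :: r, C => ∑ j ∈ C, colCoeff b C j • (x i j * minor b x r (C.erase j))

theorem minor_nil (b : κ → κ → ℂ) (x : ι → κ → A) (C : Finset κ) : minor b x [] C = 1 := rfl

theorem minor_cons (b : κ → κ → ℂ) (x : ι → κ → A) (i : ι) (r : List ι) (C : Finset κ) :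
    minor b x (i :: r) C = ∑ j ∈ C, colCoeff b C j • (x i j * minor b x r (C.erase j)) := rfl

theorem map_minor {B : Type*} [Ring B] [Algebra ℂ B] (f : A →ₐ[ℂ] B) (b : κ → κ → ℂ)
    (x : ι → κ → A) (r : List ι) (C : Finset κ) :
    f (minor b x r C) = minor b (fun i j => f (x i j)) r C := by
  induction r generalizing C with
  | nil => simp [minor]
  | cons i r ih => simp [minor_cons, ih]

/-- The `2 × 2` quantum minor. -/
def minorTwo (b : κ → κ → ℂ) (x : ι → κ → A) (i j : ι) (k l : κ) : A :=
  x i k * x j l - b k l • (x i l * x j k)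

/-- The rows of `x` anticommute, up to the scalars `a`, in the quantum exterior algebra with
parameters `b`. -/
structure IsAlternating (a : ι → ι → ℂ) (b : κ → κ → ℂ) (x : ι → κ → A) : Prop where
  self : ∀ i k l, k < l → minorTwo b x i i k l = 0
  swap : ∀ i j k l, i ≠ j → k < l → minorTwo b x j i k l = -a i j • minorTwo b x i j k l

/-- Expanding along two rows, the terms for the column pairs `(k, l)` and `(l, k)` have the same
remaining minor, and their coefficients differ by the factor `-b k l`, so they combine to a `2 × 2`
minor. Every exchange of adjacent rows is thereby a statement about `2 × 2` minors. -/
theorem minor_cons_cons (b : κ → κ → ℂ) (x : ι → κ → A) (i j : ι) (r : List ι) (C : Finset κ) :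
    minor b x (i :: j :: r) C = ∑ k ∈ C, ∑ l ∈ C, if k < l then
      (colCoeff b C k * colCoeff b (C.erase k) l) •
        (minorTwo b x i j k l * minor b x r ((C.erase k).erase l)) else 0 := by
  set f : κ → κ → A := fun k l => (colCoeff b C k * colCoeff b (C.erase k) l) •
    (x i k * x j l * minor b x r ((C.erase k).erase l)) with hf
  have h1 : minor b x (i :: j :: r) C = ∑ k ∈ C, ∑ l ∈ C,
      ((if k < l then f k l else 0) + if l < k then f k l else 0) := by
    rw [minor_cons]
    refine Finset.sum_congr rfl fun k hk => ?_
    rw [minor_cons, ← Finset.add_sum_erase C _ hk]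
    simp only [lt_irrefl, if_false, add_zero, zero_add]
    rw [Finset.mul_sum, Finset.smul_sum]
    refine Finset.sum_congr rfl fun l hl => ?_
    rcases lt_trichotomy k l with h | h | h
    · simp [h, h.not_gt, hf, mul_smul, mul_assoc]
    · exact absurd h.symm (Finset.mem_erase.1 hl).1
    · simp [h, h.not_gt, hf, mul_smul, mul_assoc]
  rw [h1]
  simp only [Finset.sum_add_distrib]
  rw [Finset.sum_comm (f := fun k l => if l < k then f k l else 0), ← Finset.sum_add_distrib]
  refine Finset.sum_congr rfl fun k hk => ?_
  rw [← Finset.sum_add_distrib]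
  refine Finset.sum_congr rfl fun l hl => ?_
  split_ifs with h
  · simp only [hf, minorTwo]
    rw [colCoeff_eq_mul_erase b hk h, colCoeff_erase_of_le b C h.le, Finset.erase_right_comm,
      sub_mul, smul_sub, smul_mul_assoc, smul_smul, sub_eq_add_neg, ← neg_smul]
    congr 2
    ring
  · simp

variable {a : ι → ι → ℂ} {b : κ → κ → ℂ} {x : ι → κ → A}

theorem IsAlternating.minor_self (h : IsAlternating a b x) (i : ι) (r : List ι) (C : Finset κ) :
    minor b x (i :: i :: r) C = 0 := by
  rw [minor_cons_cons]
  refine Finset.sum_eq_zero fun k _ => Finset.sum_eq_zero fun l _ => ?_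
  split_ifs with hkl
  · rw [h.self i k l hkl, zero_mul, smul_zero]
  · rfl

theorem IsAlternating.minor_swap (h : IsAlternating a b x) {i j : ι} (hij : i ≠ j) (r : List ι)
    (C : Finset κ) : minor b x (j :: i :: r) C = -a i j • minor b x (i :: j :: r) C := by
  rw [minor_cons_cons, minor_cons_cons, Finset.smul_sum]
  refine Finset.sum_congr rfl fun k _ => ?_
  rw [Finset.smul_sum]
  refine Finset.sum_congr rfl fun l _ => ?_
  split_ifs with hkl
  · rw [h.swap i j k l hij hkl, smul_mul_assoc, smul_comm]
  · rw [smul_zero]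

theorem minor_cons_congr {r s : List ι} {c : ℂ} (h : ∀ C, minor b x r C = c • minor b x s C)
    (i : ι) (C : Finset κ) : minor b x (i :: r) C = c • minor b x (i :: s) C := by
  rw [minor_cons, minor_cons, Finset.smul_sum]
  refine Finset.sum_congr rfl fun j _ => ?_
  rw [h, mul_smul_comm, smul_comm]

/-- Exchanges bring the two copies of the row together, where the minor vanishes. -/
theorem IsAlternating.minor_cons_of_mem (h : IsAlternating a b x) {i : ι} {r : List ι}
    (hi : i ∈ r) (C : Finset κ) : minor b x (i :: r) C = 0 := by
  induction r generalizing C with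
  | nil => simp at hi
  | cons j r ih =>
    by_cases hij : j = i
    · subst hij
      exact h.minor_self j r C
    · rw [h.minor_swap hij]
      have := minor_cons_congr (b := b) (x := x) (r := i :: r) (s := i :: r) (c := 0)
        (fun C => by rw [ih (by simpa [Ne.symm hij] using hi), smul_zero]) j C
      rw [this, zero_smul, smul_zero]

/-- The scalar collects the exchanges that carry row `i` to the front. It must not depend on `C`,
since the inductive step applies it inside an expansion, to all the smaller column sets. -/
theorem IsAlternating.minor_cons_erase [DecidableEq ι] (h : IsAlternating a b x)
    (ha : ∀ i j, a i j ≠ 0) {i : ι} {r : List ι} (hi : i ∈ r) :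
    ∃ c : ℂ, c ≠ 0 ∧ ∀ C, minor b x (i :: r.erase i) C = c • minor b x r C := by
  induction r with
  | nil => simp at hi
  | cons j r ih =>
    by_cases hij : j = i
    · subst hij
      exact ⟨1, one_ne_zero, fun C => by simp⟩
    · obtain ⟨c, hc, h'⟩ := ih (by simpa [Ne.symm hij] using hi)
      refine ⟨-a j i * c, mul_ne_zero (neg_ne_zero.2 (ha j i)) hc, fun C => ?_⟩
      rw [List.erase_cons_tail (by simpa using hij), h.minor_swap hij, minor_cons_congr h',
        mul_smul]

/-- The product of `-b k l` over the inversions of a list. -/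
noncomputable def listInv (b : κ → κ → ℂ) : List κ → ℂ
  | [] => 1
  | j :: L => colCoeff b L.toFinset j * listInv b L

theorem listInv_ne_zero (hb : ∀ k l, b k l ≠ 0) (L : List κ) : listInv b L ≠ 0 := by
  induction L with
  | nil => exact one_ne_zero
  | cons j L ih => exact mul_ne_zero (colCoeff_ne_zero hb _ _) ih

theorem IsAlternating.minor_cons_sorted [LinearOrder ι] (h : IsAlternating a b x) {i : ι}
    {r : List ι} (hi : i ∉ r) (hr : r.Pairwise (· ≤ ·)) (hn : r.Nodup) (C : Finset κ) :
    minor b x (i :: r) C =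
      colCoeff a r.toFinset i • minor b x (r.orderedInsert (· ≤ ·) i) C := by
  induction r generalizing C with
  | nil => simp [colCoeff]
  | cons j r ih =>
    rw [List.mem_cons, not_or] at hi
    rw [List.orderedInsert_cons]
    split_ifs with hij
    · rw [colCoeff, Finset.filter_false_of_mem, Finset.prod_empty, one_smul]
      · intro k hk
        rw [List.mem_toFinset, List.mem_cons] at hk
        rcases hk with rfl | hk
        · exact not_lt.2 hij
        · exact not_lt.2 (hij.trans ((List.pairwise_cons.1 hr).1 k hk))
    · rw [h.minor_swap (Ne.symm hi.1), minor_cons_congr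
        (fun C => ih hi.2 (List.pairwise_cons.1 hr).2 (List.nodup_cons.1 hn).2 C), smul_smul,
        List.toFinset_cons, colCoeff_eq_mul_erase a (Finset.mem_insert_self j _) (not_le.1 hij),
        Finset.erase_insert (by simpa using (List.nodup_cons.1 hn).1)]

theorem IsAlternating.minor_insertionSort [LinearOrder ι] (h : IsAlternating a b x)
    {r : List ι} (hr : r.Nodup) (C : Finset κ) :
    minor b x r C = listInv a r • minor b x (r.insertionSort (· ≤ ·)) C := by
  induction r generalizing C with
  | nil => simp [listInv]
  | cons i r ih =>
    rw [List.nodup_cons] at hr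
    rw [minor_cons_congr (fun C => ih hr.2 C), List.insertionSort_cons,
      h.minor_cons_sorted (by simpa using hr.1) (r.pairwise_insertionSort _)
        ((List.perm_insertionSort _ r).nodup_iff.2 hr.2), smul_smul, listInv, mul_comm]
    congr 2
    rw [List.toFinset_eq_of_perm _ _ (List.perm_insertionSort _ r)]

/-- The full expansion of a quantum minor. -/
theorem minor_eq_sum [Fintype κ] (b : κ → κ → ℂ) (x : ι → κ → A) (r : List ι) (C : Finset κ)
    (S : Finset (List κ))
    (hS : ∀ L, L ∈ S ↔ L.Nodup ∧ L.toFinset = C) (hC : C.card = r.length) :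
    minor b x r C = ∑ L ∈ S, listInv b L • (List.zipWith x r L).prod := by
  induction r generalizing C S with
  | nil =>
    have : S = {[]} := by
      ext L
      simp only [List.length_nil, Finset.card_eq_zero] at hC
      simp only [hS, hC, List.toFinset_eq_empty_iff, Finset.mem_singleton]
      constructor
      · exact fun h => h.2
      · rintro rfl
        simp
    simp [this, minor, listInv]
  | cons i r ih =>
    classical
    -- Removing the head `j` matches the enumerations of `C` that begin with `j` with the
    -- enumerations of `C.erase j`.
    have key : ∀ j ∈ C, minor b x r (C.erase j) =
        ∑ L ∈ (S.filter fun L => L.head? = some j).image List.tail,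
          listInv b L • (List.zipWith x r L).prod := by
      intro j hj
      refine ih _ _ (fun L => ?_) (by rw [Finset.card_erase_of_mem hj, hC]; simp)
      simp only [Finset.mem_image, Finset.mem_filter, hS]
      constructor
      · rintro ⟨L', ⟨⟨h1, h2⟩, h3⟩, rfl⟩
        cases L' with
        | nil => simp at h3
        | cons k L' =>
          obtain rfl : k = j := by simpa using h3
          rw [List.nodup_cons] at h1
          refine ⟨h1.2, ?_⟩
          rw [← h2, List.tail_cons, List.toFinset_cons, Finset.erase_insert]
          simpa using h1.1
      · rintro ⟨h1, h2⟩
        refine ⟨j :: L, ⟨⟨List.nodup_cons.2 ⟨?_, h1⟩, ?_⟩, rfl⟩, rfl⟩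
        · rw [← List.mem_toFinset, h2]
          simp
        · rw [List.toFinset_cons, h2, Finset.insert_erase hj]
    rw [minor_cons, ← Finset.sum_fiberwise_of_maps_to (s := S) (t := C.map
      Function.Embedding.some) (g := List.head?)]
    · rw [Finset.sum_map]
      refine Finset.sum_congr rfl fun j hj => ?_
      rw [key j hj, Finset.sum_image, Finset.mul_sum, Finset.smul_sum]
      · refine Finset.sum_congr rfl fun L hL => ?_
        simp only [Finset.mem_filter, hS, Function.Embedding.some_apply] at hL
        obtain ⟨⟨h1, h2⟩, h3⟩ := hL
        cases L with
        | nil => simp at h3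
        | cons k L =>
          obtain rfl : k = j := by simpa using h3
          rw [List.tail_cons, listInv, List.zipWith_cons_cons, List.prod_cons, mul_smul_comm,
            smul_smul, ← h2, List.toFinset_cons, ← colCoeff_erase_of_le b _ le_rfl,
            Finset.erase_insert]
          simpa using (List.nodup_cons.1 h1).1
      · intro L hL L' hL' hh
        simp only [Finset.coe_filter, Set.mem_ofPred_eq] at hL hL'
        cases L <;> cases L' <;> simp_all
    · intro L hL
      rw [hS] at hL
      cases L with
      | nil =>
        rw [List.toFinset_nil] at hL
        simp [← hL.2] at hC
      | cons k L => simp [← hL.2]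

end Minor

/-! ### Operators with a leading exponent over an ordered group. -/

section Lead

variable {Γ : Type*} [AddCommGroup Γ] [LinearOrder Γ] [IsOrderedCancelAddMonoid Γ]

/-- The vectors supported on the exponents smaller than `γ`. -/
abbrev below (γ : Γ) : Submodule ℂ (Γ →₀ ℂ) := Finsupp.supported ℂ ℂ (Set.Iio γ)

theorem single_mem_below {α γ : Γ} (h : α < γ) (c : ℂ) : Finsupp.single α c ∈ below γ :=
  Finsupp.single_mem_supported ℂ c h

/-- `f` sends every basis vector `e α` to vectors supported below `α + β`. -/
def IsLower (f : Module.End ℂ (Γ →₀ ℂ)) (β : Γ) : Prop :=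
  ∀ α, f (Finsupp.single α 1) ∈ below (α + β)

/-- `f` sends every basis vector `e α` to a vector with leading exponent `α + β`. -/
def HasLead (f : Module.End ℂ (Γ →₀ ℂ)) (β : Γ) : Prop :=
  ∀ α, ∃ c : ℂ, c ≠ 0 ∧
    f (Finsupp.single α 1) - Finsupp.single (α + β) c ∈ below (α + β)

variable {f g : Module.End ℂ (Γ →₀ ℂ)} {β γ : Γ}

theorem HasLead.isLower (hf : HasLead f β) (h : β < γ) : IsLower f γ := by
  intro α
  obtain ⟨c, _, hc⟩ := hf α
  have hlt : α + β < α + γ := by gcongr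
  rw [← sub_add_cancel (f (Finsupp.single α 1)) (Finsupp.single (α + β) c)]
  exact add_mem (Finsupp.supported_mono (Set.Iio_subset_Iio hlt.le) hc) (single_mem_below hlt c)

theorem HasLead.map_below (hf : HasLead f β) {w : Γ →₀ ℂ} (hw : w ∈ below γ) :
    f w ∈ below (γ + β) := by
  rw [below, Finsupp.supported_eq_span_single] at hw
  induction hw using Submodule.span_induction with
  | mem w hw =>
    obtain ⟨α, hα, rfl⟩ := hw
    obtain ⟨c, _, hc⟩ := hf α
    have hlt : α + β < γ + β := by
      have : α < γ := hα
      gcongr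
    rw [← sub_add_cancel (f (Finsupp.single α 1)) (Finsupp.single (α + β) c)]
    exact add_mem (Finsupp.supported_mono (Set.Iio_subset_Iio hlt.le) hc) (single_mem_below hlt c)
  | zero => simp
  | add _ _ _ _ h1 h2 => rw [map_add]; exact add_mem h1 h2
  | smul c _ _ h => rw [map_smul]; exact Submodule.smul_mem _ c h

theorem HasLead.mul (hf : HasLead f β) (hg : HasLead g γ) : HasLead (f * g) (β + γ) := by
  intro α
  obtain ⟨c, hc0, hc⟩ := hg α
  obtain ⟨d, hd0, hd⟩ := hf (α + γ)
  refine ⟨c * d, mul_ne_zero hc0 hd0, ?_⟩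
  have h1 := hf.map_below hc
  have h2 := Submodule.smul_mem _ c hd
  rw [show α + (β + γ) = α + γ + β by abel]
  convert add_mem h1 h2 using 1
  rw [map_sub, Module.End.mul_apply, smul_sub, Finsupp.smul_single, ← map_smul,
    Finsupp.smul_single, smul_eq_mul, smul_eq_mul, mul_one]
  abel

theorem HasLead.one : HasLead (1 : Module.End ℂ (Γ →₀ ℂ)) (0 : Γ) :=
  fun α => ⟨1, one_ne_zero, by simp⟩

theorem HasLead.smul (hf : HasLead f β) {c : ℂ} (hc : c ≠ 0) : HasLead (c • f) β := by
  intro α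
  obtain ⟨d, hd0, hd⟩ := hf α
  refine ⟨c * d, mul_ne_zero hc hd0, ?_⟩
  convert Submodule.smul_mem _ c hd using 1
  rw [smul_sub, Finsupp.smul_single, LinearMap.smul_apply, smul_eq_mul]

theorem HasLead.add_isLower (hf : HasLead f β) (hg : IsLower g β) : HasLead (f + g) β := by
  intro α
  obtain ⟨d, hd0, hd⟩ := hf α
  refine ⟨d, hd0, ?_⟩
  rw [LinearMap.add_apply, add_sub_right_comm]
  exact add_mem hd (hg α)

theorem isLower_sum {ι : Type*} {s : Finset ι} {F : ι → Module.End ℂ (Γ →₀ ℂ)}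
    (h : ∀ i ∈ s, IsLower (F i) β) : IsLower (∑ i ∈ s, F i) β := by
  intro α
  rw [LinearMap.sum_apply]
  exact sum_mem fun i hi => h i hi α

theorem HasLead.ne_zero (hf : HasLead f β) : f ≠ 0 := by
  rintro rfl
  obtain ⟨c, hc0, hc⟩ := hf 0
  rw [LinearMap.zero_apply, zero_sub, neg_mem_iff, Finsupp.mem_supported,
    Finsupp.support_single _ hc0] at hc
  simp at hc

/-- With distinct leading exponents the largest one cannot be cancelled. This is the source of all
the nonvanishing results. -/
theorem exists_hasLead_sum {ι : Type*} {s : Finset ι} (hs : s.Nonempty)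
    {F : ι → Module.End ℂ (Γ →₀ ℂ)} {e : ι → Γ} (he : Set.InjOn e s)
    (h : ∀ i ∈ s, HasLead (F i) (e i)) : ∃ i ∈ s, HasLead (∑ i ∈ s, F i) (e i) := by
  classical
  obtain ⟨i, hi, hmax⟩ := s.exists_max_image e hs
  refine ⟨i, hi, ?_⟩
  rw [← Finset.add_sum_erase s F hi]
  refine (h i hi).add_isLower (isLower_sum fun j hj => ?_)
  rw [Finset.mem_erase] at hj
  exact (h j hj.2).isLower ((hmax j hj.2).lt_of_ne fun hh => hj.1 (he hj.2 hi hh))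

end Lead

/-! ### The quantum torus acting by weighted shifts. -/

section Torus

variable {ι : Type*}

/-- The operator `e α ↦ χ α • e (α + β)`. -/
noncomputable def shift {Γ : Type*} [Add Γ] (χ : Γ → ℂ) (β : Γ) : Module.End ℂ (Γ →₀ ℂ) :=
  Finsupp.linearCombination ℂ fun α => Finsupp.single (α + β) (χ α)

theorem shift_single {Γ : Type*} [Add Γ] (χ : Γ → ℂ) (β α : Γ) :
    shift χ β (Finsupp.single α 1) = Finsupp.single (α + β) (χ α) := by
  simp [shift]

theorem end_ext {Γ : Type*} {f g : Module.End ℂ (Γ →₀ ℂ)}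
    (h : ∀ α, f (Finsupp.single α 1) = g (Finsupp.single α 1)) : f = g :=
  Finsupp.lhom_ext' fun α => LinearMap.ext_ring (h α)

theorem shift_mul_single {Γ : Type*} [Add Γ] (χ ψ : Γ → ℂ) (β γ α : Γ) :
    (shift χ β * shift ψ γ) (Finsupp.single α 1) =
      Finsupp.single (α + γ + β) (ψ α * χ (α + γ)) := by
  rw [Module.End.mul_apply, shift_single, ← mul_one (ψ α), ← smul_eq_mul, ← Finsupp.smul_single,
    map_smul, shift_single, Finsupp.smul_single, smul_eq_mul, smul_eq_mul, mul_one]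

theorem hasLead_shift {Γ : Type*} [AddCommGroup Γ] [LinearOrder Γ] [IsOrderedCancelAddMonoid Γ]
    {χ : Γ → ℂ} (hχ : ∀ α, χ α ≠ 0) (β : Γ) : HasLead (shift χ β) β :=
  fun α => ⟨χ α, hχ α, by rw [shift_single, sub_self]; exact zero_mem _⟩

/-- The exponent of the variable `a`. -/
def expo [DecidableEq ι] (a : ι) : Lex (ι → ℤ) := toLex (Pi.single a 1)

/-- There are invertible operators with prescribed `q`-commutation relations and independent
leading exponents. -/
theorem exists_torus [LinearOrder ι] [Fintype ι] (lam : ι → ι → ℂ) (hlam : ∀ a b, lam a b ≠ 0) :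
    ∃ Y : ι → (Module.End ℂ (Lex (ι → ℤ) →₀ ℂ))ˣ,
      (∀ a b, a < b → (Y a * Y b : Module.End ℂ (Lex (ι → ℤ) →₀ ℂ)) =
        lam a b • (Y b * Y a : Module.End ℂ (Lex (ι → ℤ) →₀ ℂ))) ∧
      (∀ a, HasLead (Y a : Module.End ℂ (Lex (ι → ℤ) →₀ ℂ)) (expo a)) ∧
      ∀ a, HasLead (↑(Y a)⁻¹ : Module.End ℂ (Lex (ι → ℤ) →₀ ℂ)) (-expo a) := by
  -- A character that sees only the exponents of variables after `a`: for `a < b`, shifting first by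
  -- `b` gives `Y a` the extra factor `lam a b`, while shifting first by `a` gives `Y b` none.
  set χ : ι → Lex (ι → ℤ) → ℂ := fun a α => ∏ b with a < b, lam a b ^ (ofLex α b) with hχ
  have hχ0 : ∀ a α, χ a α ≠ 0 := fun a α =>
    Finset.prod_ne_zero_iff.2 fun b _ => zpow_ne_zero _ (hlam a b)
  have hχadd : ∀ a α β, χ a (α + β) = χ a α * χ a β := by
    intro a α β
    simp only [hχ]
    rw [← Finset.prod_mul_distrib]
    exact Finset.prod_congr rfl fun b _ => by rw [ofLex_add, Pi.add_apply, zpow_add₀ (hlam a b)]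
  have hχlt : ∀ a b, a < b → χ a (expo b) = lam a b := by
    intro a b hab
    simp only [hχ]
    rw [Finset.prod_eq_single b]
    · simp [expo]
    · intro c _ hc
      simp [expo, hc]
    · simp [hab]
  have hχge : ∀ a b, a < b → χ b (expo a) = 1 := by
    intro a b hab
    simp only [hχ]
    refine Finset.prod_eq_one fun c hc => ?_
    have : c ≠ a := by
      rintro rfl
      exact hab.not_gt (by simpa using hc)
    simp [expo, this]
  refine ⟨fun a => ⟨shift (χ a) (expo a), shift (fun α => (χ a (α - expo a))⁻¹) (-expo a),
    end_ext fun α => ?_, end_ext fun α => ?_⟩, fun a b hab => end_ext fun α => ?_, fun a => ?_,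
    fun a => ?_⟩
  · rw [shift_mul_single, ← sub_eq_add_neg, inv_mul_cancel₀ (hχ0 a _), sub_add_cancel]
    rfl
  · rw [shift_mul_single, add_sub_cancel_right, mul_inv_cancel₀ (hχ0 a _), add_neg_cancel_right]
    rfl
  · rw [LinearMap.smul_apply, shift_mul_single, shift_mul_single, Finsupp.smul_single, hχadd,
      hχadd, hχlt a b hab, hχge a b hab, add_right_comm]
    congr 1
    rw [smul_eq_mul]
    ring
  · exact hasLead_shift (hχ0 a) _
  · exact hasLead_shift (fun α => inv_ne_zero (hχ0 a _)) _

end Torus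

/-! ### Shearing rows by a row of units preserves the relations. -/

section Relations

variable {κ A : Type*} [LinearOrder κ] [Ring A] [Algebra ℂ A]

/-- The relations between the entries of one row. -/
def RowSelf (b : κ → κ → ℂ) (x : κ → A) : Prop :=
  ∀ k l, k < l → x k * x l = b k l • (x l * x k)

/-- The relations between the entries of the row `x` and of a lower row `y`; the scalar `c` is the
parameter of this pair of rows. -/
structure RowPair (c : ℂ) (b : κ → κ → ℂ) (v : ℂ) (x y : κ → A) : Prop where
  col : ∀ k, x k * y k = (v / c) • (y k * x k)
  anti : ∀ k l, k < l → b k l • (x l * y k) = (v / c) • (y k * x l)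
  cross : ∀ k l, k < l →
    (b k l)⁻¹ • (x k * y l) - c⁻¹ • (y l * x k) = (1 - v⁻¹) • (x l * y k)

/-- The relations of one row of a quantum matrix after normalisation of the columns. -/
def UniSelf (v : ℂ) (z : κ → A) : Prop :=
  ∀ k l, k < l → z k * z l = v • (z l * z k)

/-- The relations of two rows of a quantum matrix after normalisation of the columns. -/
structure UniPair (v ρ : ℂ) (z w : κ → A) : Prop where
  col : ∀ k, z k * w k = ρ • (w k * z k)
  anti : ∀ k l, k < l → v • (z l * w k) = ρ • (w k * z l)
  cross : ∀ k l, k < l → z k * w l - ρ • (w l * z k) = (v - 1) • (z l * w k)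

theorem UniSelf.sum {v : ℂ} {z : κ → A} (h : UniSelf v z) {S T : Finset κ}
    (hST : ∀ k ∈ S, ∀ l ∈ T, k < l) :
    (∑ k ∈ S, z k) * ∑ l ∈ T, z l = v • ((∑ l ∈ T, z l) * ∑ k ∈ S, z k) := by
  rw [Finset.sum_mul_sum, Finset.sum_mul_sum, Finset.smul_sum, Finset.sum_comm]
  refine Finset.sum_congr rfl fun l hl => ?_
  rw [Finset.smul_sum]
  exact Finset.sum_congr rfl fun k hk => h k l (hST k hk l hl)

theorem UniPair.sum_anti {v ρ : ℂ} {z w : κ → A} (h : UniPair v ρ z w) {S T : Finset κ}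
    (hST : ∀ k ∈ S, ∀ l ∈ T, k < l) :
    v • ((∑ l ∈ T, z l) * ∑ k ∈ S, w k) = ρ • ((∑ k ∈ S, w k) * ∑ l ∈ T, z l) := by
  rw [Finset.sum_mul_sum, Finset.sum_mul_sum, Finset.sum_comm]
  simp only [Finset.smul_sum]
  exact Finset.sum_congr rfl fun k hk => Finset.sum_congr rfl fun l hl =>
    h.anti k l (hST k hk l hl)

theorem UniPair.sum_cross {v ρ : ℂ} {z w : κ → A} (h : UniPair v ρ z w) {S T : Finset κ}
    (hST : ∀ k ∈ S, ∀ l ∈ T, k < l) :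
    (∑ k ∈ S, z k) * ∑ l ∈ T, w l - ρ • ((∑ l ∈ T, w l) * ∑ k ∈ S, z k) =
      (v - 1) • ((∑ l ∈ T, z l) * ∑ k ∈ S, w k) := by
  rw [Finset.sum_mul_sum, Finset.sum_mul_sum, Finset.sum_mul_sum,
    Finset.sum_comm (s := T) (t := S) (f := fun l k => w l * z k),
    Finset.sum_comm (s := T) (t := S) (f := fun l k => z l * w k)]
  simp only [Finset.smul_sum, ← Finset.sum_sub_distrib]
  exact Finset.sum_congr rfl fun k hk => Finset.sum_congr rfl fun l hl =>
    h.cross k l (hST k hk l hl)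

/-- The defect `z k * w l - ρ • (w l * z k)` is antisymmetric in `k` and `l`: by `cross` and `anti`
it is `(v - 1) • (z l * w k)` for `k < l`, and the opposite after exchanging the indices. So its sum
over `S × S` vanishes. -/
theorem UniPair.sum_col {v ρ : ℂ} {z w : κ → A} (h : UniPair v ρ z w) (S : Finset κ) :
    (∑ k ∈ S, z k) * ∑ l ∈ S, w l = ρ • ((∑ l ∈ S, w l) * ∑ k ∈ S, z k) := by
  set F : κ → κ → A := fun k l => z k * w l - ρ • (w l * z k) with hF
  have hanti : ∀ k l, F k l = -F l k := by
    have hlt : ∀ k l, k < l → F k l = -F l k := by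
      intro k l hkl
      simp only [hF]
      rw [h.cross k l hkl, ← h.anti k l hkl]
      module
    intro k l
    rcases lt_trichotomy k l with hkl | rfl | hkl
    · exact hlt k l hkl
    · simp [hF, h.col k]
    · rw [hlt l k hkl, neg_neg]
  have hsum : ∑ k ∈ S, ∑ l ∈ S, F k l = 0 := by
    have : ∑ k ∈ S, ∑ l ∈ S, F k l = -∑ k ∈ S, ∑ l ∈ S, F k l := by
      conv_lhs => rw [Finset.sum_comm]
      simp only [← Finset.sum_neg_distrib]
      exact Finset.sum_congr rfl fun k _ => Finset.sum_congr rfl fun l _ => hanti l k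
    have h2 : (2 : ℂ) • ∑ k ∈ S, ∑ l ∈ S, F k l = 0 := by
      rw [two_smul]
      nth_rewrite 1 [this]
      rw [neg_add_cancel]
    exact (smul_eq_zero.1 h2).resolve_left two_ne_zero
  rw [← sub_eq_zero, ← hsum, Finset.sum_mul_sum, Finset.sum_mul_sum,
    Finset.sum_comm (s := S) (t := S) (f := fun l k => w l * z k)]
  simp only [Finset.smul_sum, ← Finset.sum_sub_distrib, hF]

theorem units_inv_mul_of_mul {u : Aˣ} {x : A} {s : ℂ} (h : x * u = s • (u * x)) :
    ↑u⁻¹ * x = s • (x * ↑u⁻¹) := by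
  calc ↑u⁻¹ * x = ↑u⁻¹ * (x * u) * ↑u⁻¹ := by simp [mul_assoc]
    _ = s • (x * ↑u⁻¹) := by simp [h]

/-- The scalar `v` if `l ≤ k`, and `1` otherwise. -/
noncomputable def jump (v : ℂ) (k l : κ) : ℂ := if l ≤ k then v else 1

theorem jump_of_le {v : ℂ} {k l : κ} (h : l ≤ k) : jump v k l = v := if_pos h

theorem jump_of_lt {v : ℂ} {k l : κ} (h : k < l) : jump v k l = 1 := if_neg h.not_ge

/-- The entries of the row `y` `q`-commute with those of the row of units `ξ`, as the leading terms
in a quantum matrix do. -/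
def Compat (b : κ → κ → ℂ) (v : ℂ) (ξ : κ → Aˣ) (μ : ℂ) (y : κ → A) : Prop :=
  ∀ k l, y k * ξ l = (μ * b k l * jump v k l) • (ξ l * y k)

variable {b : κ → κ → ℂ} {v : ℂ} {ξ : κ → Aˣ}

/-- Dividing column `k` by `ξ k` cancels the factor `b k l`. What remains depends on the columns
only through their order, so it is constant on the blocks of columns that occur in a shear. -/
theorem Compat.normalised_mul (hb : ∀ k l, b k l * b l k = 1)
    (hξ : ∀ k l, (ξ k * ξ l : A) = b k l • (ξ l * ξ k : A)) {μ : ℂ} {y : κ → A}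
    (hy : Compat b v ξ μ y) (k l : κ) :
    (y k * ↑(ξ k)⁻¹) * ξ l = (μ * jump v k l) • (ξ l * (y k * ↑(ξ k)⁻¹)) := by
  rw [mul_assoc, units_inv_mul_of_mul (hξ l k), mul_smul_comm, ← mul_assoc, hy k l, smul_mul_assoc,
    smul_smul, mul_assoc, mul_assoc]
  congr 1
  linear_combination μ * jump v k l * hb k l

theorem Compat.normalised_mul_normalised
    {μ' : ℂ} {y y' : κ → A} (hy' : Compat b v ξ μ' y') (k l : κ) :
    (y k * ↑(ξ k)⁻¹) * (y' l * ↑(ξ l)⁻¹) =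
      (μ' * b l k * jump v l k) • (y k * y' l * (↑(ξ k)⁻¹ * ↑(ξ l)⁻¹)) := by
  rw [mul_assoc, ← mul_assoc _ (y' l), units_inv_mul_of_mul (hy' l k)]
  simp only [smul_mul_assoc, mul_smul_comm, mul_assoc]

theorem inv_mul_inv_comm (hξ : ∀ k l, (ξ k * ξ l : A) = b k l • (ξ l * ξ k : A)) (k l : κ) :
    (↑(ξ l)⁻¹ * ↑(ξ k)⁻¹ : A) = b l k • (↑(ξ k)⁻¹ * ↑(ξ l)⁻¹ : A) := by
  have h' := units_inv_mul_of_mul (hξ l k)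
  exact units_inv_mul_of_mul (u := ξ l) (x := ↑(ξ k)⁻¹) (s := b l k) h'

theorem normalised_uniSelf
    (hξ : ∀ k l, (ξ k * ξ l : A) = b k l • (ξ l * ξ k : A)) {μ : ℂ} {y : κ → A}
    (hy : Compat b v ξ μ y) (hs : RowSelf b y) : UniSelf v fun k => y k * ↑(ξ k)⁻¹ := by
  intro k l hkl
  simp only
  rw [hy.normalised_mul_normalised k l, hy.normalised_mul_normalised l k, hs k l hkl,
    inv_mul_inv_comm hξ k l, jump_of_le hkl.le, jump_of_lt hkl]
  simp only [smul_mul_assoc, mul_smul_comm, smul_smul]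
  congr 1
  ring

/-- After normalisation the scalars no longer depend on the columns, so the relations can be summed
over blocks; this makes the sums in a shear tractable. -/
theorem normalised_uniPair (hb : ∀ k l, b k l * b l k = 1) (hbd : ∀ k, b k k = 1)
    (hv : v ≠ 0)
    (hξ : ∀ k l, (ξ k * ξ l : A) = b k l • (ξ l * ξ k : A)) {μ μ' c : ℂ} (hc : c ≠ 0)
    (hμ : μ ≠ 0) {y y' : κ → A}
    (hy : Compat b v ξ μ y) (hy' : Compat b v ξ μ' y') (h : RowPair c b v y y') :
    UniPair v (μ' * v / (μ * c)) (fun k => y k * ↑(ξ k)⁻¹) fun k => y' k * ↑(ξ k)⁻¹ := by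
  have hb0 : ∀ k l, b k l ≠ 0 := fun k l => left_ne_zero_of_mul_eq_one (hb k l)
  refine ⟨fun k => ?_, fun k l hkl => ?_, fun k l hkl => ?_⟩
  · rw [hy'.normalised_mul_normalised k k, hy.normalised_mul_normalised k k, h.col k, hbd,
      jump_of_le le_rfl]
    simp only [smul_mul_assoc, smul_smul]
    congr 1
    field_simp
  · rw [hy'.normalised_mul_normalised l k, hy.normalised_mul_normalised k l,
      inv_mul_inv_comm hξ k l, jump_of_le hkl.le, jump_of_lt hkl]
    have := congrArg (fun t => t * (↑(ξ k)⁻¹ * ↑(ξ l)⁻¹ : A)) (h.anti k l hkl)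
    simp only [smul_mul_assoc, mul_smul_comm, smul_smul] at this ⊢
    have hbi := hb k l
    linear_combination (norm := skip) (μ' * v * b l k) • this
    match_scalars
    · ring
    · field_simp
      ring
  · rw [hy'.normalised_mul_normalised k l, hy.normalised_mul_normalised l k,
      hy'.normalised_mul_normalised l k,
      inv_mul_inv_comm hξ k l, jump_of_le hkl.le, jump_of_lt hkl]
    have := congrArg (fun t => t * (↑(ξ k)⁻¹ * ↑(ξ l)⁻¹ : A)) (h.cross k l hkl)
    simp only [smul_mul_assoc, mul_smul_comm, smul_smul, sub_mul] at this ⊢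
    have hlk : b l k = (b k l)⁻¹ := eq_inv_of_mul_eq_one_right (hb k l)
    have h0 := hb0 k l
    rw [hlk]
    linear_combination (norm := skip) (μ' * v) • this
    match_scalars <;> field_simp <;> ring

variable [Fintype κ]

/-- The product of the row `y` with the triangular matrix `(ξ k)⁻¹ * ξ j`, `j ≤ k`. -/
def shear (ξ : κ → Aˣ) (y : κ → A) (j : κ) : A :=
  (∑ k with j ≤ k, y k * ↑(ξ k)⁻¹) * ξ j

theorem sum_ge_eq_add (z : κ → A) {j l : κ} (h : j < l) :
    ∑ k with j ≤ k, z k = ∑ k with j ≤ k ∧ k < l, z k + ∑ k with l ≤ k, z k := by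
  rw [← Finset.sum_union]
  · refine Finset.sum_congr ?_ fun _ _ => rfl
    ext k
    simp only [Finset.mem_filter, Finset.mem_univ, true_and, Finset.mem_union]
    constructor
    · intro hk
      rcases lt_or_ge k l with h1 | h1
      · exact Or.inl ⟨hk, h1⟩
      · exact Or.inr h1
    · rintro (hk | hk)
      · exact hk.1
      · exact h.le.trans hk
  · rw [Finset.disjoint_left]
    intro k h1 h2
    simp only [Finset.mem_filter, Finset.mem_univ, true_and] at h1 h2
    exact h1.2.not_ge h2

theorem sum_mul_unit {z : κ → A} {μ : ℂ} {l : κ} (S : Finset κ) {c : ℂ}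
    (hz : ∀ k ∈ S, z k * ξ l = (μ * jump v k l) • (ξ l * z k)) (hc : ∀ k ∈ S, jump v k l = c) :
    (∑ k ∈ S, z k) * ξ l = (μ * c) • (ξ l * ∑ k ∈ S, z k) := by
  rw [Finset.sum_mul, Finset.mul_sum, Finset.smul_sum]
  exact Finset.sum_congr rfl fun k hk => by rw [hz k hk, hc k hk]

theorem mul_mul_of_mul_eq_smul {x u : A} {c : ℂ} (h : x * u = c • (u * x)) (t : A) :
    x * (u * t) = c • (u * (x * t)) := by
  rw [← mul_assoc, h, smul_mul_assoc, mul_assoc]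

/-- For `j < l`, the entries `j` and `l` of a sheared row in terms of two sums that `q`-commute with
`ξ j` and `ξ l`. -/
theorem shear_decomp (hb : ∀ k l, b k l * b l k = 1)
    (hξ : ∀ k l, (ξ k * ξ l : A) = b k l • (ξ l * ξ k : A)) {μ : ℂ} {y : κ → A}
    (hy : Compat b v ξ μ y) {j l : κ} (h : j < l) :
    ∃ d s : A, d = ∑ k with j ≤ k ∧ k < l, y k * ↑(ξ k)⁻¹ ∧
      s = ∑ k with l ≤ k, y k * ↑(ξ k)⁻¹ ∧
      shear ξ y j = (d + s) * ξ j ∧ shear ξ y l = s * ξ l ∧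
      d * ξ j = (μ * v) • (ξ j * d) ∧ d * ξ l = μ • (ξ l * d) ∧
      s * ξ j = (μ * v) • (ξ j * s) ∧ s * ξ l = (μ * v) • (ξ l * s) := by
  have hz := hy.normalised_mul hb hξ
  refine ⟨_, _, rfl, rfl, ?_, rfl, ?_, ?_, ?_, ?_⟩
  · rw [shear, sum_ge_eq_add _ h]
  · refine sum_mul_unit _ (fun k _ => hz k j) fun k hk => jump_of_le ?_
    simp only [Finset.mem_filter] at hk
    exact hk.2.1
  · rw [← mul_one μ]
    refine sum_mul_unit _ (fun k _ => hz k l) fun k hk => jump_of_lt ?_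
    simp only [Finset.mem_filter] at hk
    exact hk.2.2
  · refine sum_mul_unit _ (fun k _ => hz k j) fun k hk => jump_of_le ?_
    simp only [Finset.mem_filter] at hk
    exact h.le.trans hk.2
  · refine sum_mul_unit _ (fun k _ => hz k l) fun k hk => jump_of_le ?_
    simp only [Finset.mem_filter] at hk
    exact hk.2

theorem ge_block (j l : κ) : ∀ k ∈ ({k | j ≤ k ∧ k < l} : Finset κ),
    ∀ m ∈ ({m | l ≤ m} : Finset κ), k < m := by
  intro k hk m hm
  simp only [Finset.mem_filter] at hk hm
  exact hk.2.2.trans_le hm.2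

/-- Writing the entries as `(d + s) * ξ j` and `s * ξ l`, every pair among `d`, `s`, `ξ j`, `ξ l`
`q`-commutes, so both sides can be put in the same normal order and compared. -/
theorem shear_rowSelf (hb : ∀ k l, b k l * b l k = 1) (hv : v ≠ 0)
    (hξ : ∀ k l, (ξ k * ξ l : A) = b k l • (ξ l * ξ k : A)) {μ : ℂ} (hμ : μ ≠ 0) {y : κ → A}
    (hy : Compat b v ξ μ y) (hs : RowSelf b y) : RowSelf b (shear ξ y) := by
  intro j l h
  obtain ⟨d, s, hd, hs', e1, e2, d1, d2, s1, s2⟩ := shear_decomp hb hξ hy h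
  have hself := (normalised_uniSelf hξ hy hs).sum (ge_block j l)
  simp only at hself
  rw [← hd, ← hs'] at hself
  rw [e1, e2]
  have hlj : b l j = (b j l)⁻¹ := eq_inv_of_mul_eq_one_right (hb j l)
  have h0 : b j l ≠ 0 := left_ne_zero_of_mul_eq_one (hb j l)
  have d2' := mul_mul_of_mul_eq_smul d2
  have s1' := mul_mul_of_mul_eq_smul s1
  have s2' := mul_mul_of_mul_eq_smul s2
  have x1 := hξ l j
  have x1' := mul_mul_of_mul_eq_smul x1
  simp only [add_mul, mul_add, mul_assoc, smul_add, smul_mul_assoc, mul_smul_comm, smul_smul,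
    d1, s1, s2, d2', s1', s2', x1', hself, hlj]
  match_scalars <;> field_simp

/-- The row `ξ` becomes the next row of the matrix. In `cross` the part `d` drops out because it
passes `ξ l` with scalar `μ`, while `s` passes it with scalar `μ * v` and leaves exactly the term
with `1 - v⁻¹`. -/
theorem shear_rowPair_unit (hb : ∀ k l, b k l * b l k = 1) (hv : v ≠ 0)
    (hξ : ∀ k l, (ξ k * ξ l : A) = b k l • (ξ l * ξ k : A)) {μ : ℂ} (hμ : μ ≠ 0) {y : κ → A}
    (hy : Compat b v ξ μ y) : RowPair μ⁻¹ b v (shear ξ y) fun k => ξ k := by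
  have hz := hy.normalised_mul hb hξ
  refine ⟨fun k => ?_, fun j l h => ?_, fun j l h => ?_⟩
  · have := sum_mul_unit (l := k) {m | k ≤ m} (c := v) (fun m _ => hz m k) fun m hm =>
      jump_of_le (by simpa using hm)
    rw [shear, this, smul_mul_assoc, mul_assoc, this]
    simp only [mul_smul_comm, smul_smul, mul_assoc]
    match_scalars
    field_simp
  all_goals
    obtain ⟨d, s, -, -, e1, e2, d1, d2, s1, s2⟩ := shear_decomp hb hξ hy h
    have hlj : b l j = (b j l)⁻¹ := eq_inv_of_mul_eq_one_right (hb j l)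
    have h0 : b j l ≠ 0 := left_ne_zero_of_mul_eq_one (hb j l)
    have x1 := hξ l j
    have x1' := mul_mul_of_mul_eq_smul x1
    simp only [e1, e2, add_mul, mul_add, mul_assoc, smul_add, smul_mul_assoc, mul_smul_comm,
      smul_smul, d1, d2, s1, s2, x1', hlj]
    match_scalars <;> field_simp <;> ring

/-- Again a comparison of normal orders; the products of a sum from one row with a sum from the
other are governed by the block forms of the normalised relations. -/
theorem shear_rowPair (hb : ∀ k l, b k l * b l k = 1) (hbd : ∀ k, b k k = 1)
    (hv : v ≠ 0)
    (hξ : ∀ k l, (ξ k * ξ l : A) = b k l • (ξ l * ξ k : A)) {μ μ' c : ℂ} (hc : c ≠ 0)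
    (hμ : μ ≠ 0) (hμ' : μ' ≠ 0) {y y' : κ → A}
    (hy : Compat b v ξ μ y) (hy' : Compat b v ξ μ' y') (h : RowPair c b v y y') :
    RowPair c b v (shear ξ y) (shear ξ y') := by
  have hu := normalised_uniPair hb hbd hv hξ hc hμ hy hy' h
  have hz := hy.normalised_mul hb hξ
  have hz' := hy'.normalised_mul hb hξ
  refine ⟨fun k => ?_, fun j l h => ?_, fun j l h => ?_⟩
  · have h1 := sum_mul_unit (l := k) {m | k ≤ m} (c := v) (fun m _ => hz m k) fun m hm =>
      jump_of_le (by simpa using hm)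
    have h2 := sum_mul_unit (l := k) {m | k ≤ m} (c := v) (fun m _ => hz' m k) fun m hm =>
      jump_of_le (by simpa using hm)
    have h3 := hu.sum_col {m | k ≤ m}
    rw [shear, shear]
    generalize ∑ m with k ≤ m, y m * ↑(ξ m)⁻¹ = S at *
    generalize ∑ m with k ≤ m, y' m * ↑(ξ m)⁻¹ = S' at *
    have h1' := mul_mul_of_mul_eq_smul h1
    have h2' := mul_mul_of_mul_eq_smul h2
    simp only [smul_mul_assoc, mul_smul_comm, smul_smul, mul_assoc, h1, h2, h1', h2', h3]
    match_scalars
    field_simp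
  all_goals
    obtain ⟨d, s, hd, hs, e1, e2, d1, d2, s1, s2⟩ := shear_decomp hb hξ hy h
    obtain ⟨d', s', hd', hs', f1, f2, g1, g2, t1, t2⟩ := shear_decomp hb hξ hy' h
    have r2 := hu.sum_col {k | l ≤ k}
    have r3 := hu.sum_anti (ge_block j l)
    have r4 := hu.sum_cross (ge_block j l)
    simp only [← hd, ← hs, ← hd', ← hs'] at r2 r3 r4
    rw [← eq_inv_smul_iff₀ hv] at r3
    rw [sub_eq_iff_eq_add, r3] at r4
    have hlj : b l j = (b j l)⁻¹ := eq_inv_of_mul_eq_one_right (hb j l)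
    have h0 : b j l ≠ 0 := left_ne_zero_of_mul_eq_one (hb j l)
    have d2' := mul_mul_of_mul_eq_smul d2
    have s1' := mul_mul_of_mul_eq_smul s1
    have s2' := mul_mul_of_mul_eq_smul s2
    have g2' := mul_mul_of_mul_eq_smul g2
    have t1' := mul_mul_of_mul_eq_smul t1
    have t2' := mul_mul_of_mul_eq_smul t2
    have x1 := hξ l j
    have x1' := mul_mul_of_mul_eq_smul x1
    simp only [e1, e2, f1, f2, add_mul, mul_add, mul_assoc, smul_add, smul_mul_assoc,
      mul_smul_comm, smul_smul, d1, s1, s2, d2', s1', s2', g1, t1, t2, g2', t1',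
      t2', x1', hlj, r2, r3, r4]
    match_scalars <;> field_simp <;> ring

end Relations

/-! ### Building a quantum matrix row by row, and eliminating it again. -/

section Stage

variable {A : Type*} [Ring A] [Algebra ℂ A] {n : ℕ} {b : Fin n → Fin n → ℂ} {v : ℂ}

/-- In `y k * (ξ k)⁻¹ * ξ j` the column factors of `y k` and `(ξ k)⁻¹` cancel when moved past `η l`,
so every summand acquires the same scalar, with the column factor of `ξ j`. Rows already sheared
thus stay ready for shearing by later rows. -/
theorem Compat.shear {κ : Type*} [LinearOrder κ] [Fintype κ] {b : κ → κ → ℂ}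
    {η ξ : κ → Aˣ} {μ ν : ℂ} {y : κ → A} (hy : Compat b v η μ y)
    (hξ : Compat b v η ν fun k => (ξ k : A)) (hb : ∀ k l, b k l ≠ 0) (hν : ν ≠ 0) (hv : v ≠ 0) :
    Compat b v η μ (shear ξ y) := by
  have hj : ∀ k l : κ, jump v k l ≠ 0 := by
    intro k l
    unfold jump
    split_ifs <;> simp [hv]
  have hinv : ∀ k l, (↑(ξ k)⁻¹ * η l : A) =
      (ν * b k l * jump v k l)⁻¹ • (η l * ↑(ξ k)⁻¹ : A) := by
    intro k l
    have h := hξ k l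
    rw [eq_comm, inv_smul_eq_iff₀ (mul_ne_zero (mul_ne_zero hν (hb k l)) (hj k l))]
    calc (η l * ↑(ξ k)⁻¹ : A) = ↑(ξ k)⁻¹ * (ξ k * η l) * ↑(ξ k)⁻¹ := by simp
      _ = _ := by rw [h]; simp [mul_assoc]
  intro j l
  rw [QuantumMatrix.shear, mul_assoc, hξ j l, Finset.sum_mul, Finset.sum_mul, Finset.mul_sum,
    Finset.smul_sum]
  refine Finset.sum_congr rfl fun k _ => ?_
  have h1 := mul_mul_of_mul_eq_smul (hinv k l)
  have h2 := mul_mul_of_mul_eq_smul (hy k l)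
  simp only [mul_smul_comm, mul_assoc, h1, h2, smul_smul]
  congr 1
  have := hb k l
  have := hj k l
  field_simp

/-- The matrix obtained from the matrix of units `Y` by adding its first `r` rows one at a time,
each new row shearing the previous ones. -/
def stage (Y : Fin n → Fin n → Aˣ) : ℕ → Fin n → Fin n → A
  | 0, i => fun k => Y i k
  | r + 1, i => if h : i.val < r ∧ r < n then shear (Y ⟨r, h.2⟩) (stage Y r i) else stage Y r i

theorem stage_succ_of_lt (Y : Fin n → Fin n → Aˣ) {r : ℕ} {i : Fin n} (hi : i.val < r)
    (hr : r < n) : stage Y (r + 1) i = shear (Y ⟨r, hr⟩) (stage Y r i) := by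
  rw [stage, dif_pos ⟨hi, hr⟩]

theorem stage_of_le (Y : Fin n → Fin n → Aˣ) {r : ℕ} {i : Fin n} (hi : r ≤ i.val + 1) :
    stage Y r i = fun k => (Y i k : A) := by
  induction r with
  | zero => rfl
  | succ r ih => rw [stage, dif_neg (by omega), ih (by omega)]

variable {a : Fin n → Fin n → ℂ} {Y : Fin n → Fin n → Aˣ}

theorem stage_compat (hb : ∀ k l, b k l ≠ 0) (ha : ∀ i j, a i j ≠ 0) (hv : v ≠ 0)
    (hY : ∀ i m, i < m → Compat b v (Y m) (a i m)⁻¹ fun k => (Y i k : A)) (r : ℕ) {i m : Fin n}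
    (him : i < m) (hr : r ≤ m.val) : Compat b v (Y m) (a i m)⁻¹ (stage Y r i) := by
  induction r with
  | zero => exact hY i m him
  | succ r ih =>
    rw [stage]
    split_ifs with h
    · exact (ih (by omega)).shear (hY ⟨r, h.2⟩ m (by rw [Fin.lt_def]; exact hr)) hb
        (inv_ne_zero (ha _ _)) hv
    · exact ih (by omega)

theorem stage_relations (hb : ∀ k l, b k l * b l k = 1) (hbd : ∀ k, b k k = 1)
    (ha : ∀ i j, a i j ≠ 0) (hv : v ≠ 0)
    (hY : ∀ i m, i < m → Compat b v (Y m) (a i m)⁻¹ fun k => (Y i k : A))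
    (hYs : ∀ i k l, (Y i k * Y i l : A) = b k l • (Y i l * Y i k : A)) (r : ℕ) (hr : r ≤ n) :
    (∀ i, RowSelf b (stage Y r i)) ∧
      ∀ i j : Fin n, i < j → j.val < r → RowPair (a i j) b v (stage Y r i) (stage Y r j) := by
  have hb0 : ∀ k l, b k l ≠ 0 := fun k l => left_ne_zero_of_mul_eq_one (hb k l)
  induction r with
  | zero => exact ⟨fun i k l _ => hYs i k l, fun i j _ h => absurd h (Nat.not_lt_zero _)⟩
  | succ r ih =>
    obtain ⟨ih1, ih2⟩ := ih (by omega)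
    have hcomp : ∀ {i : Fin n} (_ : i.val < r),
        Compat b v (Y ⟨r, hr⟩) (a i ⟨r, hr⟩)⁻¹ (stage Y r i) := fun {i} hi =>
      stage_compat hb0 ha hv hY r (m := ⟨r, hr⟩) hi le_rfl
    constructor
    · intro i
      rw [stage]
      split_ifs with h
      · exact shear_rowSelf hb hv (hYs _) (inv_ne_zero (ha _ _)) (hcomp h.1) (ih1 i)
      · exact ih1 i
    · intro i j hij hj
      -- Either both rows are sheared by row `r`, or the lower one is row `r` itself, still
      -- unsheared.
      rcases (Nat.lt_succ_iff.1 hj).lt_or_eq with h | h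
      · rw [stage_succ_of_lt Y h hr, stage_succ_of_lt Y (lt_trans hij h) hr]
        exact shear_rowPair hb hbd hv (hYs _) (ha _ _) (inv_ne_zero (ha _ _))
          (inv_ne_zero (ha _ _)) (hcomp (lt_trans hij h)) (hcomp h) (ih2 i j hij h)
      · subst h
        rw [stage_succ_of_lt Y hij hr, stage_of_le Y (i := j) le_rfl, ← inv_inv (a i j)]
        exact shear_rowPair_unit hb hv (hYs _) (inv_ne_zero (ha _ _)) (hcomp hij)

/-- Gaussian elimination: a combination of the rows `≥ l` of the final stage, with coefficient `1`
at the row `l`, is supported on the diagonal. -/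
theorem exists_stage_elimination (Y : Fin n → Fin n → Aˣ) (l : Fin n) (r : ℕ) (hlr : l.val < r)
    (hr : r ≤ n) :
    ∃ w : Fin n → A, w l = 1 ∧ ∀ j, l ≤ j → j.val < r →
      ∑ i with l ≤ i ∧ i.val < r, w i * stage Y r i j = if j = l then (Y l l : A) else 0 := by
  induction r with
  | zero => exact absurd hlr (Nat.not_lt_zero _)
  | succ r ih =>
    rcases (Nat.lt_succ_iff.1 hlr).lt_or_eq with h | h
    · obtain ⟨w, hw1, hw⟩ := ih h (by omega)
      set ρ : Fin n := ⟨r, hr⟩ with hρ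
      set z : Fin n → A := fun k => (∑ i with l ≤ i ∧ i.val < r, w i * stage Y r i k) *
        ↑(Y ρ k)⁻¹ with hz
      have hlρ : l < ρ := h
      have hz0 : ∀ k, l < k → k < ρ → z k = 0 := fun k h1 h2 => by
        simp only [hz, hw k h1.le h2, if_neg h1.ne', zero_mul]
      have hzl : z l * Y ρ l = Y l l := by
        simp only [hz, hw l le_rfl h, if_true]
        rw [mul_assoc, Units.inv_mul, mul_one]
      -- After the shear the old combination has entry `(∑ k ≥ j, z k) * Y ρ j` in column `j`. As
      -- `z` vanishes strictly between `l` and `ρ`, for `l < j ≤ ρ` only the tail from `ρ` on is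
      -- left, and this multiple of the new row removes it. At `j = l` the extra term `z l * Y ρ l =
      -- Y l l` survives.
      refine ⟨Function.update w ρ (-∑ k with ρ ≤ k, z k), ?_, fun j hj hjr => ?_⟩
      · rw [Function.update_of_ne hlρ.ne, hw1]
      · have hset : ({i | l ≤ i ∧ i.val < r + 1} : Finset (Fin n)) =
            insert ρ ({i | l ≤ i ∧ i.val < r} : Finset (Fin n)) := by
          ext i
          simp only [Finset.mem_filter, Finset.mem_univ, true_and, Finset.mem_insert, Fin.ext_iff,
            hρ, Fin.le_def]
          omega
        have hsum : ∑ i with l ≤ i ∧ i.val < r,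
            Function.update w ρ (-∑ k with ρ ≤ k, z k) i * stage Y (r + 1) i j =
              (∑ k with j ≤ k, z k) * Y ρ j := by
          simp only [hz, Finset.sum_mul]
          conv_rhs => rw [Finset.sum_comm]
          refine Finset.sum_congr rfl fun i hi => ?_
          simp only [Finset.mem_filter, Finset.mem_univ, true_and] at hi
          rw [Function.update_of_ne (Fin.ne_of_lt hi.2), stage_succ_of_lt Y hi.2 hr, shear,
            Finset.sum_mul, Finset.mul_sum]
          exact Finset.sum_congr rfl fun k _ => by simp only [mul_assoc, hρ]
        rw [hset, Finset.sum_insert (by simp [hρ]), hsum, Function.update_self,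
          stage_of_le Y (by simp [hρ])]
        rcases hj.eq_or_lt with rfl | hj'
        · have hblock : ∑ k with l ≤ k ∧ k < ρ, z k = z l := by
            refine Finset.sum_eq_single l (fun k hk hkl => ?_) (by simp [hlρ])
            simp only [Finset.mem_filter, Finset.mem_univ, true_and] at hk
            exact hz0 k (lt_of_le_of_ne hk.1 hkl.symm) hk.2
          rw [sum_ge_eq_add z hlρ, hblock, add_mul, hzl, neg_mul, if_pos rfl]
          abel
        · have : ∑ k with j ≤ k, z k = ∑ k with ρ ≤ k, z k := by
            rcases (Nat.lt_succ_iff.1 hjr).lt_or_eq with h1 | h1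
            · rw [sum_ge_eq_add z (show j < ρ from h1), Finset.sum_eq_zero, zero_add]
              intro k hk
              simp only [Finset.mem_filter, Finset.mem_univ, true_and] at hk
              exact hz0 k (hj'.trans_le hk.1) hk.2
            · rw [show j = ρ from Fin.ext h1]
          rw [this, if_neg hj'.ne', neg_mul, neg_add_cancel]
    · refine ⟨1, rfl, fun j hj hjr => ?_⟩
      obtain rfl : j = l := Fin.ext (by rw [Fin.le_def] at hj; omega)
      rw [if_pos rfl, Finset.sum_eq_single j]
      · rw [stage_of_le Y (by omega)]
        simp
      · intro i hi hij
        simp only [Finset.mem_filter, Finset.mem_univ, true_and] at hi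
        exact absurd (Fin.ext (by rw [Fin.le_def] at hi; omega)) hij
      · simp [h]

end Stage

/-! ### The representation of the algebra on the quantum torus. -/

section Embedding

variable {n : ℕ}

/-- The exponents of the monomials in the generators. -/
abbrev Expo (n : ℕ) : Type := Lex (Fin n ×ₗ Fin n → ℤ)

/-- The exponent of the generator at the position `(i, k)`. -/
def genExpo (i k : Fin n) : Expo n := expo (toLex (i, k))

/-- The left side is the exponent of an off-diagonal term of a shear. The first coordinate where the
two sides differ is `(i, j)`, which precedes all positions on the left and has the value `0` there
and `1` on the right. -/
theorem genExpo_lt {i r j k : Fin n} (hir : i < r) (hjk : j < k) :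
    genExpo i k + -genExpo r k + genExpo r j < genExpo i j := by
  have h1 : (toLex (i, j) : Fin n ×ₗ Fin n) < toLex (i, k) :=
    Prod.Lex.toLex_lt_toLex.2 (Or.inr ⟨rfl, hjk⟩)
  have h2 : ∀ m, (toLex (i, j) : Fin n ×ₗ Fin n) < toLex (r, m) := fun m =>
    Prod.Lex.toLex_lt_toLex.2 (Or.inl hir)
  set e : Fin n ×ₗ Fin n → Fin n ×ₗ Fin n → ℤ := fun a => Pi.single a 1 with he
  refine ⟨toLex (i, j), fun c hc => ?_, ?_⟩
  · change c < toLex (i, j) at hc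
    change (e (toLex (i, k)) + -e (toLex (r, k)) + e (toLex (r, j))) c = e (toLex (i, j)) c
    simp [he, hc.ne, (hc.trans h1).ne, (hc.trans (h2 k)).ne, (hc.trans (h2 j)).ne]
  · change (e (toLex (i, k)) + -e (toLex (r, k)) + e (toLex (r, j))) (toLex (i, j)) <
      e (toLex (i, j)) (toLex (i, j))
    simp [he, h1.ne, (h2 k).ne, (h2 j).ne]

theorem stage_hasLead {Y : Fin n → Fin n → (Module.End ℂ (Expo n →₀ ℂ))ˣ}
    (hY : ∀ i k, HasLead (Y i k : Module.End ℂ (Expo n →₀ ℂ)) (genExpo i k))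
    (hY' : ∀ i k, HasLead (↑(Y i k)⁻¹ : Module.End ℂ (Expo n →₀ ℂ)) (-genExpo i k))
    (r : ℕ) (i k : Fin n) : HasLead (stage Y r i k) (genExpo i k) := by
  induction r generalizing i k with
  | zero => exact hY i k
  | succ r ih =>
    rw [stage]
    split_ifs with h
    · rw [shear, Finset.sum_mul, ← Finset.add_sum_erase _ _ (show k ∈ _ by simp)]
      refine HasLead.add_isLower ?_ (isLower_sum fun m hm => ?_)
      · rw [mul_assoc, Units.inv_mul, mul_one]
        exact ih i k
      · simp only [Finset.mem_erase, Finset.mem_filter, Finset.mem_univ, true_and] at hm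
        exact (((ih i m).mul (hY' _ m)).mul (hY _ k)).isLower
          (genExpo_lt h.1 (lt_of_le_of_ne hm.2 hm.1.symm))
    · exact ih i k

variable {p q : Fin n → Fin n → ℂ} {u : ℂ}

theorem IsParameter.q_ne_zero (h : IsParameter p q u) (i j : Fin n) : q i j ≠ 0 :=
  left_ne_zero_of_mul_eq_one (h.q_mul_symm i j)

theorem IsParameter.p_ne_zero (h : IsParameter p q u) (i j : Fin n) : p i j ≠ 0 :=
  left_ne_zero_of_mul_eq_one (h.p_mul_symm i j)

theorem IsParameter.u_ne_zero (h : IsParameter p q u) {i j : Fin n} (hij : i < j) : u ^ 2 ≠ 0 := by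
  rw [← h.mul_eq i j hij]
  exact mul_ne_zero (h.p_ne_zero i j) (h.q_ne_zero i j)

theorem IsParameter.p_eq (h : IsParameter p q u) {i j : Fin n} (hij : i < j) :
    p i j = u ^ 2 / q i j := by
  rw [eq_div_iff (h.q_ne_zero i j), h.mul_eq i j hij]

/-- The algebra homomorphism from `M_{p,u}(n)` given by a matrix that satisfies the relations. -/
theorem exists_lift {A : Type*} [Ring A] [Algebra ℂ A] (h : IsParameter p q u)
    (x : Fin n → Fin n → A) (hs : ∀ i, RowSelf q (x i))
    (hp : ∀ i j, i < j → RowPair (q i j) q (u ^ 2) (x i) (x j)) :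
    ∃ φ : QMat p q u →ₐ[ℂ] A, ∀ i j, φ (genMatrix p q u i j) = x i j := by
  set f : FreeAlgebra ℂ (Fin n × Fin n) →ₐ[ℂ] A := FreeAlgebra.lift ℂ fun a => x a.1 a.2 with hf
  have hf' : ∀ i j, f (gen i j) = x i j := fun i j => by simp [hf, gen]
  have hrel : ∀ ⦃a b⦄, Rel p q u a b → f a = f b := by
    intro a b hab
    induction hab with
    | row i k l hkl => simpa [hf'] using hs i k l hkl
    | col i j k hij => simpa [hf', h.p_eq hij] using (hp i j hij).col k
    | anti i j k l hij hkl => simpa [hf', h.p_eq hij] using (hp i j hij).anti k l hkl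
    | cross i j k l hij hkl => simpa [hf'] using (hp i j hij).cross k l hkl
  refine ⟨(RingQuot.liftAlgHom ℂ ⟨f, hrel⟩ : RingQuot (Rel p q u) →ₐ[ℂ] A), fun i j => ?_⟩
  rw [← hf' i j]
  exact RingQuot.liftAlgHom_mkAlgHom_apply ℂ f hrel (gen i j)

theorem mk_eq_of_rel {a b : FreeAlgebra ℂ (Fin n × Fin n)} (h : Rel p q u a b) :
    mk p q u a = mk p q u b :=
  RingQuot.mkAlgHom_rel ℂ h

theorem mk_gen (i j : Fin n) : mk p q u (gen i j) = genMatrix p q u i j := rfl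

theorem genMatrix_rowSelf (i : Fin n) : RowSelf q (genMatrix p q u i) := by
  intro k l hkl
  have := mk_eq_of_rel (Rel.row (p := p) (q := q) (u := u) i k l hkl)
  simpa [mk_gen] using this

theorem genMatrix_rowPair (h : IsParameter p q u) {i j : Fin n} (hij : i < j) :
    RowPair (q i j) q (u ^ 2) (genMatrix p q u i) (genMatrix p q u j) := by
  refine ⟨fun k => ?_, fun k l hkl => ?_, fun k l hkl => ?_⟩
  · have := mk_eq_of_rel (Rel.col (p := p) (q := q) (u := u) i j k hij)
    simpa [← h.p_eq hij, mk_gen] using this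
  · have := mk_eq_of_rel (Rel.anti (p := p) (q := q) (u := u) i j k l hij hkl)
    simpa [← h.p_eq hij, mk_gen] using this
  · have := mk_eq_of_rel (Rel.cross (p := p) (q := q) (u := u) i j k l hij hkl)
    simpa [mk_gen] using this

/-- A representation of `M_{p,u}(n)` on the quantum torus. -/
theorem exists_representation (h : IsParameter p q u) :
    ∃ (φ : QMat p q u →ₐ[ℂ] Module.End ℂ (Expo n →₀ ℂ))
      (y : Fin n → Module.End ℂ (Expo n →₀ ℂ)),
      (∀ i k, HasLead (φ (genMatrix p q u i k)) (genExpo i k)) ∧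
      (∀ l m, Commute (y l) (y m)) ∧
      ∀ l, ∃ w : Fin n → Module.End ℂ (Expo n →₀ ℂ), w l = 1 ∧ ∀ j, l ≤ j →
        ∑ i with l ≤ i, w i * φ (genMatrix p q u i j) = if j = l then y l else 0 := by
  classical
  -- The shears need `v ≠ 0`. The value `u ^ 2 = 0` is possible only when there is no pair `i < j`,
  -- and then `v` enters none of the relations between rows, so `1` serves as a default.
  set v : ℂ := if u ^ 2 = 0 then 1 else u ^ 2 with hvdef
  have hv : v ≠ 0 := by
    rw [hvdef]
    split_ifs with h0
    · exact one_ne_zero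
    · exact h0
  have hveq : ∀ {i j : Fin n}, i < j → v = u ^ 2 := fun hij => if_neg (h.u_ne_zero hij)
  have hj : ∀ k l : Fin n, jump v k l ≠ 0 := by
    intro k l
    unfold jump
    split_ifs <;> simp [hv]
  -- The commutation scalars are those demanded by `RowSelf` within a row and by `Compat` between
  -- rows. The choice `μ = (q i m)⁻¹` is the one for which `shear_rowPair_unit` yields the row
  -- parameter `q i m`.
  obtain ⟨Y, hYc, hYl, hYl'⟩ := exists_torus (ι := Fin n ×ₗ Fin n)
    (fun a b => if (ofLex a).1 = (ofLex b).1 then q (ofLex a).2 (ofLex b).2 else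
      (q (ofLex a).1 (ofLex b).1)⁻¹ * q (ofLex a).2 (ofLex b).2 *
        jump v (ofLex a).2 (ofLex b).2) (by
      intro a b
      split_ifs
      · exact h.q_ne_zero _ _
      · exact mul_ne_zero (mul_ne_zero (inv_ne_zero (h.q_ne_zero _ _)) (h.q_ne_zero _ _)) (hj _ _))
  set Z : Fin n → Fin n → (Module.End ℂ (Expo n →₀ ℂ))ˣ := fun i k => Y (toLex (i, k)) with hZ
  have hcompat : ∀ i m, i < m → Compat q v (Z m) (q i m)⁻¹
      fun k => (Z i k : Module.End ℂ (Expo n →₀ ℂ)) := by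
    intro i m him k l
    have := hYc (toLex (i, k)) (toLex (m, l)) (Prod.Lex.toLex_lt_toLex.2 (Or.inl him))
    simpa [him.ne] using this
  have hself : ∀ i k l, (Z i k * Z i l : Module.End ℂ (Expo n →₀ ℂ)) =
      q k l • (Z i l * Z i k : Module.End ℂ (Expo n →₀ ℂ)) := by
    have hlt : ∀ i k l, k < l → (Z i k * Z i l : Module.End ℂ (Expo n →₀ ℂ)) =
        q k l • (Z i l * Z i k : Module.End ℂ (Expo n →₀ ℂ)) := by
      intro i k l hkl
      have := hYc (toLex (i, k)) (toLex (i, l)) (Prod.Lex.toLex_lt_toLex.2 (Or.inr ⟨rfl, hkl⟩))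
      simpa using this
    intro i k l
    rcases lt_trichotomy k l with hkl | rfl | hkl
    · exact hlt i k l hkl
    · rw [h.q_diag, one_smul]
    · rw [hlt i l k hkl, smul_smul, h.q_mul_symm, one_smul]
  obtain ⟨h1, h2⟩ := stage_relations h.q_mul_symm h.q_diag h.q_ne_zero hv hcompat hself n le_rfl
  obtain ⟨φ, hφ⟩ := exists_lift h (stage Z n) h1 fun i j hij => by
    rw [← hveq hij]
    exact h2 i j hij j.2
  refine ⟨φ, fun l => Z l l, fun i k => ?_, ?_, fun l => ?_⟩
  · rw [hφ]
    exact stage_hasLead (fun i k => hYl _) (fun i k => hYl' _) n i k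
  -- For diagonal positions the row scalar `(q l m)⁻¹` cancels the column scalar `q l m`, and the
  -- jump is `1`.
  · have hlt : ∀ l m, l < m → Commute (Z l l : Module.End ℂ (Expo n →₀ ℂ)) (Z m m) := by
      intro l m hlm
      have := hcompat l m hlm l m
      simp only [jump_of_lt hlm] at this
      rw [mul_one, inv_mul_cancel₀ (h.q_ne_zero l m), one_smul] at this
      exact this
    intro l m
    rcases lt_trichotomy l m with hlm | rfl | hlm
    · exact hlt l m hlm
    · exact Commute.refl _
    · exact (hlt m l hlm).symm
  · obtain ⟨w, hw1, hw⟩ := exists_stage_elimination (A := Module.End ℂ (Expo n →₀ ℂ)) Z l n l.2 le_rfl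
    refine ⟨w, hw1, fun j hj => ?_⟩
    rw [← hw j hj j.2]
    simp only [hφ, Fin.is_lt, and_true]

end Embedding

/-! ### Spanning by ordered monomials and polynomial growth. -/

section Straightening

variable {ι M : Type*} [LinearOrder ι] [Ring M] [Algebra ℂ M]

/-- The ordered monomial in `t` with the given multiset of factors. -/
noncomputable def pbw (t : ι → M) (s : Multiset ι) : M := ((s.sort (· ≤ ·)).map t).prod

theorem pbw_coe_of_sorted (t : ι → M) {L : List ι} (hL : L.Pairwise (· ≤ ·)) :
    pbw t (L : Multiset ι) = (L.map t).prod := by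
  rw [pbw]
  congr 2
  refine List.Perm.eq_of_pairwise (fun a b _ _ h1 h2 => le_antisymm h1 h2)
    (Multiset.pairwise_sort _ _) hL ?_
  rw [← Multiset.coe_eq_coe, Multiset.sort_eq]

/-- If every disordered product of two generators is a combination of products with a smaller first
factor, the words are combinations of ordered monomials. -/
theorem prod_mem_span_pbw [WellFoundedLT ι] (t : ι → M)
    (ht : ∀ a b, b < a → t a * t b ∈ Submodule.span ℂ {x | ∃ e f, e < a ∧ x = t e * t f})
    (L : List ι) :
    (L.map t).prod ∈ Submodule.span ℂ (pbw t '' {s | Multiset.card s = L.length}) := by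
  obtain ⟨d, hd⟩ : ∃ d, L.length = d := ⟨_, rfl⟩
  rw [hd]
  induction d generalizing L with
  | zero =>
    obtain rfl := List.length_eq_zero_iff.1 hd
    refine Submodule.subset_span ⟨0, rfl, ?_⟩
    simp [pbw]
  | succ d ih =>
    -- A double induction: the length hypothesis orders the tail, and if the first letter `b` of the
    -- tail is below `a`, then `t a * t b` is traded for products with first letter below `a`. The
    -- tail must be arbitrary, since the new second letter `f` may spoil its order.
    have key : ∀ (a : ι) (L : List ι), L.length = d → t a * (L.map t).prod ∈
        Submodule.span ℂ (pbw t '' {s | Multiset.card s = d + 1}) := by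
      intro a
      induction a using WellFoundedLT.induction with
      | ind a iha =>
        intro L hL
        have hmem := ih L hL
        generalize (L.map t).prod = x at hmem ⊢
        induction hmem using Submodule.span_induction with
        | mem x hx =>
          obtain ⟨s, hs, rfl⟩ := hx
          have hsl : (s.sort (· ≤ ·)).length = d := by rw [Multiset.length_sort]; exact hs
          have hsorted := Multiset.pairwise_sort s (· ≤ ·)
          rw [pbw]
          generalize s.sort (· ≤ ·) = L' at hsl hsorted
          by_cases hab : (a :: L').Pairwise (· ≤ ·)
          · refine Submodule.subset_span ⟨((a :: L' : List ι) : Multiset ι), by simp [hsl], ?_⟩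
            rw [pbw_coe_of_sorted t hab, List.map_cons, List.prod_cons]
          · cases L' with
            | nil => simp at hab
            | cons b L' =>
              have hba : b < a := by
                by_contra hcon
                rw [not_lt] at hcon
                refine hab (List.pairwise_cons.2 ⟨fun c hc => ?_, hsorted⟩)
                rcases List.mem_cons.1 hc with rfl | hc
                · exact hcon
                · exact hcon.trans ((List.pairwise_cons.1 hsorted).1 c hc)
              rw [List.map_cons, List.prod_cons, ← mul_assoc]
              have := ht a b hba
              generalize t a * t b = x at this ⊢
              induction this using Submodule.span_induction with
              | mem x hx =>
                obtain ⟨e, f, he, rfl⟩ := hx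
                have := iha e he (f :: L') (by simpa using hsl)
                rwa [List.map_cons, List.prod_cons, ← mul_assoc] at this
              | zero => simp
              | add x y _ _ hx hy => rw [add_mul]; exact add_mem hx hy
              | smul c x _ hx => rw [smul_mul_assoc]; exact Submodule.smul_mem _ c hx
        | zero => simp
        | add x y _ _ hx hy => rw [mul_add]; exact add_mem hx hy
        | smul c x _ hx => rw [mul_smul_comm]; exact Submodule.smul_mem _ c hx
    cases L with
    | nil => simp at hd
    | cons a L =>
      rw [List.map_cons, List.prod_cons]
      exact key a L (by simpa using hd)

/-- The span of the words of length at most `m`. -/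
def wordSpan (t : ι → M) (m : ℕ) : Submodule ℂ M :=
  Submodule.span ℂ {x | ∃ L : List ι, L.length ≤ m ∧ x = (L.map t).prod}

theorem wordSpan_mono (t : ι → M) {m m' : ℕ} (h : m ≤ m') : wordSpan t m ≤ wordSpan t m' :=
  Submodule.span_mono fun _ ⟨L, hL, hx⟩ => ⟨L, hL.trans h, hx⟩

theorem one_mem_wordSpan (t : ι → M) : (1 : M) ∈ wordSpan t 0 :=
  Submodule.subset_span ⟨[], by simp, by simp⟩

theorem mul_mem_wordSpan (t : ι → M) {m m' : ℕ} {x y : M} (hx : x ∈ wordSpan t m)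
    (hy : y ∈ wordSpan t m') : x * y ∈ wordSpan t (m + m') := by
  have h := Submodule.mul_mem_mul hx hy
  rw [wordSpan, wordSpan, Submodule.span_mul_span] at h
  refine Submodule.span_mono ?_ h
  rintro _ ⟨_, ⟨L, hL, rfl⟩, _, ⟨L', hL', rfl⟩, rfl⟩
  exact ⟨L ++ L', by rw [List.length_append]; omega, by simp⟩

theorem wordSpan_le_span_range [Fintype ι] (t : ι → M)
    (ht : ∀ a b, b < a → t a * t b ∈ Submodule.span ℂ {x | ∃ e f, e < a ∧ x = t e * t f})
    (m : ℕ) :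
    wordSpan t m ≤ Submodule.span ℂ (Set.range fun f : ι → Fin (m + 1) =>
      pbw t (∑ a, (f a : ℕ) • ({a} : Multiset ι))) := by
  refine Submodule.span_le.2 ?_
  rintro _ ⟨L, hL, rfl⟩
  refine Submodule.span_mono ?_ (prod_mem_span_pbw t ht L)
  rintro _ ⟨s, hs, rfl⟩
  have hs : Multiset.card s = L.length := hs
  refine ⟨fun a => ⟨s.count a, by have := s.count_le_card a; omega⟩, ?_⟩
  simp only
  congr 1
  ext a
  rw [Multiset.count_sum', Finset.sum_eq_single a] <;>
    simp +contextual [eq_comm]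

theorem finiteDimensional_wordSpan [Fintype ι] (t : ι → M)
    (ht : ∀ a b, b < a → t a * t b ∈ Submodule.span ℂ {x | ∃ e f, e < a ∧ x = t e * t f})
    (m : ℕ) : FiniteDimensional ℂ (wordSpan t m) :=
  have := FiniteDimensional.span_of_finite ℂ (Set.finite_range fun f : ι → Fin (m + 1) =>
      pbw t (∑ a, (f a : ℕ) • ({a} : Multiset ι)))
  Submodule.finiteDimensional_of_le (wordSpan_le_span_range t ht m)

theorem finrank_wordSpan_le [Fintype ι] (t : ι → M)
    (ht : ∀ a b, b < a → t a * t b ∈ Submodule.span ℂ {x | ∃ e f, e < a ∧ x = t e * t f})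
    (m : ℕ) : Module.finrank ℂ (wordSpan t m) ≤ (m + 1) ^ Fintype.card ι := by
  have := FiniteDimensional.span_of_finite ℂ (Set.finite_range fun f : ι → Fin (m + 1) =>
      pbw t (∑ a, (f a : ℕ) • ({a} : Multiset ι)))
  refine (Submodule.finrank_mono (wordSpan_le_span_range t ht m)).trans ?_
  refine (finrank_range_le_card _).trans ?_
  simp

end Straightening

/-! ### The Ore condition from growth. -/

section Ore

/-- A domain with a filtration of polynomial growth satisfies the left Ore condition. -/
theorem exists_left_common_multiple {R : Type*} [Ring R] [IsDomain R] [Algebra ℂ R]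
    (W : ℕ → Submodule ℂ R) (hmono : Monotone W) (hone : (1 : R) ∈ W 0)
    (hmul : ∀ m m' x y, x ∈ W m → y ∈ W m' → x * y ∈ W (m + m')) (htop : ∀ x, ∃ m, x ∈ W m)
    (hfin : ∀ m, FiniteDimensional ℂ (W m)) (N : ℕ)
    (hrank : ∀ m, Module.finrank ℂ (W m) ≤ (m + 1) ^ N) (r s : R) (hs : s ≠ 0) :
    ∃ r' s' : R, s' ≠ 0 ∧ s' * r = r' * s := by
  by_contra! hcon
  have hcon' : ∀ x y : R, x * r = y * s → x = 0 := fun x y h => by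
    by_contra hx
    exact hcon y x hx h
  obtain ⟨m₁, hm₁⟩ := htop r
  obtain ⟨m₂, hm₂⟩ := htop s
  set d := max m₁ m₂ with hd
  have hr : r ∈ W d := hmono (le_max_left _ _) hm₁
  have hs' : s ∈ W d := hmono (le_max_right _ _) hm₂
  -- Without a common multiple of `r` and `s`, the map `(x, y) ↦ x * r + y * s` is injective, so
  -- dimensions double at each step of size `d`; exponential growth contradicts `hrank`.
  have hstep : ∀ m, 2 * Module.finrank ℂ (W m) ≤ Module.finrank ℂ (W (m + d)) := by
    intro m
    let f : (W m × W m) →ₗ[ℂ] W (m + d) :=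
      LinearMap.codRestrict (W (m + d))
        (((LinearMap.mulRight ℂ r).comp (W m).subtype).coprod
          ((LinearMap.mulRight ℂ s).comp (W m).subtype))
        (fun x => by
          simp only [LinearMap.coprod_apply, LinearMap.comp_apply, Submodule.subtype_apply,
            LinearMap.mulRight_apply]
          exact add_mem (hmul _ _ _ _ x.1.2 hr) (hmul _ _ _ _ x.2.2 hs'))
    have hf : Function.Injective f := by
      rw [injective_iff_map_eq_zero]
      rintro ⟨x, y⟩ hxy
      have h0 : (x : R) * r + (y : R) * s = 0 := congrArg Subtype.val hxy
      have hx : (x : R) = 0 := hcon' x (-y) (by rw [neg_mul]; exact eq_neg_of_add_eq_zero_left h0)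
      have hy : (y : R) = 0 := by
        rw [hx, zero_mul, zero_add] at h0
        exact (mul_eq_zero.1 h0).resolve_right hs
      exact Prod.ext (Subtype.ext hx) (Subtype.ext hy)
    have := LinearMap.finrank_le_finrank_of_injective hf
    rw [Module.finrank_prod] at this
    omega
  have hpow : ∀ k, 2 ^ k ≤ Module.finrank ℂ (W (k * d)) := by
    intro k
    induction k with
    | zero =>
      rw [pow_zero, zero_mul]
      refine Nat.succ_le_of_lt (Module.finrank_pos_iff.2 ?_)
      exact ⟨⟨1, hone⟩, 0, fun h => one_ne_zero (congrArg Subtype.val h)⟩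
    | succ k ih =>
      rw [pow_succ, Nat.succ_mul]
      exact le_trans (by omega) (hstep (k * d))
  have hbound : ∀ k : ℕ, 1 ≤ k → (2 : ℝ) ^ k ≤ (k : ℝ) ^ N * (d + 1) ^ N := by
    intro k hk
    have h1 := (hpow k).trans (hrank (k * d))
    have h2 : k * d + 1 ≤ k * (d + 1) := by rw [mul_add]; omega
    have h3 := h1.trans (Nat.pow_le_pow_left h2 N)
    rw [mul_pow] at h3
    exact_mod_cast h3
  have hlim := tendsto_pow_const_div_const_pow_of_one_lt N (one_lt_two (α := ℝ))
  have hlim' := hlim.mul_const (((d : ℝ) + 1) ^ N)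
  rw [zero_mul] at hlim'
  obtain ⟨k, hk1, hk2⟩ := ((hlim'.eventually (gt_mem_nhds one_pos)).and
    (Filter.eventually_ge_atTop 1)).exists
  have := hbound k hk2
  rw [div_mul_eq_mul_div, div_lt_one (by positivity)] at hk1
  linarith

end Ore

/-! ### The algebra is an Ore domain. -/

section Domain

variable {n : ℕ} {p q : Fin n → Fin n → ℂ} {u : ℂ}

/-- The generators indexed by positions in lexicographic order. -/
noncomputable def lexGen (p q : Fin n → Fin n → ℂ) (u : ℂ) (a : Fin n ×ₗ Fin n) : QMat p q u :=
  genMatrix p q u (ofLex a).1 (ofLex a).2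

/-- Each relation rewrites a disordered product so that the first factors come from the upper row,
or, within one row, from the earlier column. -/
theorem lexGen_mul_mem (h : IsParameter p q u) (a b : Fin n ×ₗ Fin n) (hba : b < a) :
    lexGen p q u a * lexGen p q u b ∈ Submodule.span ℂ
      {x | ∃ e f, e < a ∧ x = lexGen p q u e * lexGen p q u f} := by
  obtain ⟨⟨i, k⟩, rfl⟩ := toLex.surjective a
  obtain ⟨⟨j, l⟩, rfl⟩ := toLex.surjective b
  set t := genMatrix p q u
  set S := Submodule.span ℂ
    {x | ∃ e f, e < toLex (i, k) ∧ x = lexGen p q u e * lexGen p q u f} with hS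
  change t i k * t j l ∈ S
  have hmem : ∀ j' l' i' k', toLex (j', l') < toLex (i, k) → t j' l' * t i' k' ∈ S :=
    fun j' l' i' k' hlt => Submodule.subset_span ⟨toLex (j', l'), toLex (i', k'), hlt, rfl⟩
  rcases Prod.Lex.toLex_lt_toLex.1 hba with hji | ⟨rfl, hlk⟩
  · have hlt : ∀ m, (toLex (j, m) : Fin n ×ₗ Fin n) < toLex (i, k) := fun m =>
      Prod.Lex.toLex_lt_toLex.2 (Or.inl hji)
    have hR := genMatrix_rowPair h hji
    have hpos : u ^ 2 / q j i ≠ 0 := div_ne_zero (h.u_ne_zero hji) (h.q_ne_zero _ _)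
    rcases lt_trichotomy k l with hkl | rfl | hkl
    · have := hR.anti k l hkl
      rw [eq_comm, ← eq_inv_smul_iff₀ hpos] at this
      change t i k * t j l = _ at this
      rw [this]
      exact Submodule.smul_mem _ _ (Submodule.smul_mem _ _ (hmem _ _ _ _ (hlt l)))
    · have := hR.col k
      rw [eq_comm, ← eq_inv_smul_iff₀ hpos] at this
      change t i k * t j k = _ at this
      rw [this]
      exact Submodule.smul_mem _ _ (hmem _ _ _ _ (hlt k))
    · have := hR.cross l k hkl
      rw [sub_eq_iff_eq_add, eq_comm, ← eq_sub_iff_add_eq',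
        ← eq_inv_smul_iff₀ (inv_ne_zero (h.q_ne_zero j i))] at this
      change t i k * t j l = _ at this
      rw [this]
      exact Submodule.smul_mem _ _ (sub_mem (Submodule.smul_mem _ _ (hmem _ _ _ _ (hlt l)))
        (Submodule.smul_mem _ _ (hmem _ _ _ _ (hlt k))))
  · have := genMatrix_rowSelf (p := p) (q := q) (u := u) j l k hlk
    rw [eq_comm, ← eq_inv_smul_iff₀ (h.q_ne_zero l k)] at this
    change t j k * t j l = _ at this
    rw [this]
    exact Submodule.smul_mem _ _ (hmem _ _ _ _ hba)

theorem exists_mem_wordSpan (x : QMat p q u) : ∃ m, x ∈ wordSpan (lexGen p q u) m := by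
  obtain ⟨a, rfl⟩ : ∃ a, mk p q u a = x := RingQuot.mkAlgHom_surjective ℂ (Rel p q u) x
  induction a using FreeAlgebra.induction with
  | grade0 c =>
    refine ⟨0, ?_⟩
    rw [AlgHom.commutes, Algebra.algebraMap_eq_smul_one]
    exact Submodule.smul_mem _ _ (one_mem_wordSpan _)
  | grade1 a =>
    exact ⟨1, Submodule.subset_span ⟨[toLex a], by simp, by simp [lexGen, ← mk_gen]⟩⟩
  | mul a b ha hb =>
    obtain ⟨m, hm⟩ := ha
    obtain ⟨m', hm'⟩ := hb
    exact ⟨m + m', by rw [map_mul]; exact mul_mem_wordSpan _ hm hm'⟩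
  | add a b ha hb =>
    obtain ⟨m, hm⟩ := ha
    obtain ⟨m', hm'⟩ := hb
    refine ⟨max m m', ?_⟩
    rw [map_add]
    exact add_mem (wordSpan_mono _ (le_max_left _ _) hm) (wordSpan_mono _ (le_max_right _ _) hm')

theorem span_range_pbw (h : IsParameter p q u) :
    Submodule.span ℂ (Set.range (pbw (lexGen p q u))) = ⊤ := by
  refine eq_top_iff.2 fun x _ => ?_
  obtain ⟨m, hm⟩ := exists_mem_wordSpan x
  refine Submodule.span_mono ?_ (wordSpan_le_span_range _ (lexGen_mul_mem h) m hm)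
  rintro _ ⟨f, rfl⟩
  exact ⟨_, rfl⟩

theorem hasLead_pbw {φ : QMat p q u →ₐ[ℂ] Module.End ℂ (Expo n →₀ ℂ)}
    (hφ : ∀ i k, HasLead (φ (genMatrix p q u i k)) (genExpo i k))
    (s : Multiset (Fin n ×ₗ Fin n)) :
    HasLead (φ (pbw (lexGen p q u) s)) (s.map expo).sum := by
  have key : ∀ L : List (Fin n ×ₗ Fin n),
      HasLead (φ (L.map (lexGen p q u)).prod) (L.map expo).sum := by
    intro L
    induction L with
    | nil => simpa using HasLead.one
    | cons a L ih =>
      rw [List.map_cons, List.prod_cons, map_mul, List.map_cons, List.sum_cons]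
      exact (hφ (ofLex a).1 (ofLex a).2).mul ih
  have := key (s.sort (· ≤ ·))
  rwa [← Multiset.sum_coe, ← Multiset.map_coe, Multiset.sort_eq] at this

theorem sum_expo_apply (s : Multiset (Fin n ×ₗ Fin n)) (a : Fin n ×ₗ Fin n) :
    ofLex (s.map expo).sum a = s.count a := by
  induction s using Multiset.induction with
  | empty => rfl
  | cons b s ih =>
    rw [Multiset.map_cons, Multiset.sum_cons, ofLex_add, Pi.add_apply, ih, Multiset.count_cons]
    simp only [expo, ofLex_toLex, Pi.single_apply]
    split_ifs <;> simp [add_comm]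

/-- The leading exponent of an ordered monomial records its multiset of factors, so distinct
monomials cannot cancel. -/
theorem exists_hasLead {φ : QMat p q u →ₐ[ℂ] Module.End ℂ (Expo n →₀ ℂ)} (h : IsParameter p q u)
    (hφ : ∀ i k, HasLead (φ (genMatrix p q u i k)) (genExpo i k)) {x : QMat p q u} (hx : x ≠ 0) :
    ∃ β, HasLead (φ x) β := by
  have hmem : x ∈ Submodule.span ℂ (Set.range (pbw (lexGen p q u))) := by
    rw [span_range_pbw h]
    trivial
  obtain ⟨c, rfl⟩ := Finsupp.mem_span_range_iff_exists_finsupp.1 hmem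
  rw [Finsupp.sum, map_sum]
  obtain ⟨s, _, hs⟩ := exists_hasLead_sum (s := c.support)
    (F := fun s => φ (c s • pbw (lexGen p q u) s)) (e := fun s => (s.map expo).sum) (by
      rw [Finsupp.support_nonempty_iff]
      rintro rfl
      simp at hx) (by
      intro s _ s' _ hss
      ext a
      have h1 := sum_expo_apply s a
      have h2 := sum_expo_apply s' a
      simp only at hss
      rw [hss, h2] at h1
      exact_mod_cast h1.symm) (by
      intro s hs
      simp only [map_smul]
      exact (hasLead_pbw hφ s).smul (Finsupp.mem_support_iff.1 hs))
  exact ⟨_, hs⟩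

theorem representation_injective {φ : QMat p q u →ₐ[ℂ] Module.End ℂ (Expo n →₀ ℂ)}
    (h : IsParameter p q u)
    (hφ : ∀ i k, HasLead (φ (genMatrix p q u i k)) (genExpo i k)) : Function.Injective φ := by
  rw [injective_iff_map_eq_zero]
  intro x hx
  by_contra hx0
  obtain ⟨β, hβ⟩ := exists_hasLead h hφ hx0
  exact hβ.ne_zero hx

theorem isDomain_qMat (h : IsParameter p q u) : IsDomain (QMat p q u) := by
  obtain ⟨φ, _, hφ, _⟩ := exists_representation h
  have hnt : Nontrivial (QMat p q u) := by
    refine ⟨0, 1, fun h01 => ?_⟩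
    have h1 : HasLead (φ 1) 0 := by
      rw [map_one]
      exact HasLead.one
    exact h1.ne_zero (by rw [← h01, map_zero])
  have hnz : NoZeroDivisors (QMat p q u) := by
    refine ⟨fun {x y} hxy => ?_⟩
    by_contra! hcon
    obtain ⟨β, hβ⟩ := exists_hasLead h hφ hcon.1
    obtain ⟨γ, hγ⟩ := exists_hasLead h hφ hcon.2
    exact (hβ.mul hγ).ne_zero (by rw [← map_mul, hxy, map_zero])
  exact NoZeroDivisors.to_isDomain _

theorem nonempty_oreSet_qMat (h : IsParameter p q u) :
    Nonempty (OreLocalization.OreSet (QMat p q u)⁰) := by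
  have := isDomain_qMat h
  rw [OreLocalization.nonempty_oreSet_iff_of_noZeroDivisors]
  intro r s
  obtain ⟨r', s', hs', hrs⟩ := exists_left_common_multiple (wordSpan (lexGen p q u))
    (fun _ _ => wordSpan_mono _) (one_mem_wordSpan _) (fun _ _ _ _ => mul_mem_wordSpan _)
    exists_mem_wordSpan (finiteDimensional_wordSpan _ (lexGen_mul_mem h)) _
    (finrank_wordSpan_le _ (lexGen_mul_mem h)) r s (nonZeroDivisors.coe_ne_zero s)
  exact ⟨r', ⟨s', mem_nonZeroDivisors_of_ne_zero hs'⟩, hrs⟩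

end Domain

/-! ### Alternation and nonvanishing of the minors of the generating matrix. -/

section Alternating

variable {n : ℕ} {p q : Fin n → Fin n → ℂ} {u : ℂ}

/-- The entries of the generating matrix. -/
noncomputable abbrev entries (p q : Fin n → Fin n → ℂ) (u : ℂ) (i j : Fin n) : QMat p q u :=
  genMatrix p q u i j

theorem isAlternating_genMatrix (h : IsParameter p q u) :
    IsAlternating q q (entries p q u) := by
  have hlt : ∀ i j k l, i < j → k < l → minorTwo q (entries p q u) j i k l =
      -q i j • minorTwo q (entries p q u) i j k l := by
    intro i j k l hij hkl
    have h1 := (genMatrix_rowPair h hij).anti k l hkl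
    have h2 := (genMatrix_rowPair h hij).cross k l hkl
    have hu := h.u_ne_zero hij
    have hq := h.q_ne_zero i j
    have hq' := h.q_ne_zero k l
    rw [eq_comm, ← eq_inv_smul_iff₀ (div_ne_zero hu hq)] at h1
    simp only [minorTwo, entries]
    rw [h1]
    linear_combination (norm := skip) (q i j * q k l) • h2
    match_scalars <;> field_simp <;> ring
  refine ⟨fun i k l hkl => ?_, fun i j k l hij hkl => ?_⟩
  · exact sub_eq_zero.2 (genMatrix_rowSelf i k l hkl)
  · rcases hij.lt_or_gt with hlt' | hgt
    · exact hlt i j k l hlt' hkl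
    · rw [hlt j i k l hgt hkl, smul_smul, neg_mul_neg, h.q_mul_symm, one_smul]

theorem IsAlternating.map {ι κ A B : Type*} [LinearOrder κ] [Ring A] [Algebra ℂ A] [Ring B]
    [Algebra ℂ B] {a : ι → ι → ℂ} {b : κ → κ → ℂ} {x : ι → κ → A} (h : IsAlternating a b x)
    (f : A →ₐ[ℂ] B) : IsAlternating a b fun i j => f (x i j) := by
  have hf : ∀ i j k l, minorTwo b (fun i j => f (x i j)) i j k l = f (minorTwo b x i j k l) := by
    simp [minorTwo]
  refine ⟨fun i k l hkl => ?_, fun i j k l hij hkl => ?_⟩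
  · rw [hf, h.self i k l hkl, map_zero]
  · rw [hf, hf, h.swap i j k l hij hkl, map_smul]

/-- The vanishing outside the rows of `r` keeps the induction going: in row `i` the exponent of a
term of the expansion then comes only from `t i j`, so different `j` give different exponents. -/
theorem exists_hasLead_minor (h : IsParameter p q u)
    {φ : QMat p q u →ₐ[ℂ] Module.End ℂ (Expo n →₀ ℂ)}
    (hφ : ∀ i k, HasLead (φ (genMatrix p q u i k)) (genExpo i k)) (r : List (Fin n))
    (hr : r.Nodup) (C : Finset (Fin n)) (hC : C.card = r.length) :
    ∃ e : Expo n, (∀ i ∉ r, ∀ k, ofLex e (toLex (i, k)) = 0) ∧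
      HasLead (φ (minor q (entries p q u) r C)) e := by
  induction r generalizing C with
  | nil =>
    refine ⟨0, fun _ _ _ => rfl, ?_⟩
    rw [minor_nil, map_one]
    exact HasLead.one
  | cons i r ih =>
    rw [List.nodup_cons] at hr
    have hne : C.Nonempty := by
      rw [← Finset.card_pos, hC]
      simp
    have hex : ∀ j, ∃ e : Expo n, j ∈ C → (∀ i ∉ r, ∀ k, ofLex e (toLex (i, k)) = 0) ∧
        HasLead (φ (minor q (entries p q u) r (C.erase j))) e := by
      intro j
      by_cases hj : j ∈ C
      · obtain ⟨e, he⟩ := ih hr.2 (C.erase j) (by rw [Finset.card_erase_of_mem hj, hC]; simp)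
        exact ⟨e, fun _ => he⟩
      · exact ⟨0, fun h => absurd h hj⟩
    choose e he using hex
    have happ : ∀ j ∈ C, ∀ k, ofLex (genExpo i j + e j) (toLex (i, k)) = if j = k then 1 else 0 := by
      intro j hj k
      rw [ofLex_add, Pi.add_apply, (he j hj).1 i hr.1 k]
      simp [genExpo, expo, Pi.single_apply, eq_comm]
    rw [minor_cons, map_sum]
    obtain ⟨j, hj, hlead⟩ := exists_hasLead_sum hne
      (F := fun j => φ (colCoeff q C j • (genMatrix p q u i j *
        minor q (entries p q u) r (C.erase j)))) (e := fun j => genExpo i j + e j) (by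
        intro j hj j' hj' hjj
        have h1 := happ j hj j
        simp only at hjj
        rw [hjj, happ j' hj' j] at h1
        by_contra hcon
        simp [Ne.symm hcon] at h1) (by
        intro j hj
        simp only [map_smul, map_mul]
        exact ((hφ i j).mul (he j hj).2).smul (colCoeff_ne_zero h.q_ne_zero C j))
    refine ⟨_, fun i' hi' k => ?_, hlead⟩
    rw [List.mem_cons, not_or] at hi'
    rw [ofLex_add, Pi.add_apply, (he j hj).1 i' hi'.2 k]
    simp [genExpo, expo, hi'.1]

theorem minor_ne_zero (h : IsParameter p q u) {r : List (Fin n)} (hr : r.Nodup)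
    {C : Finset (Fin n)} (hC : C.card = r.length) : minor q (entries p q u) r C ≠ 0 := by
  obtain ⟨φ, _, hφ, _⟩ := exists_representation h
  obtain ⟨e, _, he⟩ := exists_hasLead_minor h hφ r hr C hC
  intro h0
  exact he.ne_zero (by rw [h0, map_zero])

end Alternating

/-! ### Minors along a flag, commuting principal minors, and the quantum determinant. -/

section Tail

variable {n : ℕ}

/-- The list of the values of `σ` from the index `k` on. -/
def tailList (σ : Equiv.Perm (Fin n)) (k : ℕ) : List (Fin n) := (List.ofFn σ).drop k

theorem tailList_eq_cons (σ : Equiv.Perm (Fin n)) (k : Fin n) :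
    tailList σ k = σ k :: tailList σ (k + 1) := by
  rw [tailList, tailList, List.drop_eq_getElem_cons (by simp)]
  simp

theorem tailList_self (σ : Equiv.Perm (Fin n)) : tailList σ n = [] := by
  simp [tailList]

theorem nodup_tailList (σ : Equiv.Perm (Fin n)) (k : ℕ) : (tailList σ k).Nodup :=
  (List.nodup_ofFn.2 σ.injective).sublist (List.drop_sublist _ _)

theorem length_tailList (σ : Equiv.Perm (Fin n)) (k : ℕ) : (tailList σ k).length = n - k := by
  simp [tailList]

theorem mem_tailList (σ : Equiv.Perm (Fin n)) (k : ℕ) (i : Fin n) :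
    i ∈ tailList σ k ↔ ∀ m : Fin n, m.val < k → i ≠ σ m := by
  rw [tailList, List.mem_drop_iff_getElem]
  constructor
  · rintro ⟨j, hj, rfl⟩ m hm hcon
    rw [List.getElem_ofFn] at hcon
    have := congrArg Fin.val (σ.injective hcon)
    simp only at this
    omega
  · intro h
    have hk : k ≤ (σ.symm i).val := by
      by_contra hcon
      exact h (σ.symm i) (not_le.1 hcon) (by simp)
    refine ⟨(σ.symm i).val - k, by simp; omega, ?_⟩
    rw [List.getElem_ofFn, ← Equiv.eq_symm_apply]
    exact Fin.ext (by simp; omega)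

theorem mem_tailList_one {k : ℕ} {i : Fin n} : i ∈ tailList 1 k ↔ k ≤ i.val := by
  rw [mem_tailList]
  constructor
  · intro h
    by_contra hcon
    exact h i (not_le.1 hcon) rfl
  · rintro h m hm rfl
    exact absurd h (not_le.2 hm)

theorem card_toFinset_tailList (σ τ : Equiv.Perm (Fin n)) (k : ℕ) :
    (tailList τ k).toFinset.card = (tailList σ k).length := by
  rw [List.toFinset_card_of_nodup (nodup_tailList τ k), length_tailList, length_tailList]

theorem erase_toFinset_tailList (τ : Equiv.Perm (Fin n)) (k : Fin n) :
    (tailList τ k).toFinset.erase (τ k) = (tailList τ (k + 1)).toFinset := by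
  have hn := nodup_tailList τ k
  rw [tailList_eq_cons, List.nodup_cons] at hn
  rw [tailList_eq_cons, List.toFinset_cons, Finset.erase_insert (by simpa using hn.1)]

variable {p q : Fin n → Fin n → ℂ} {u : ℂ}

theorem listInv_tailList (τ : Equiv.Perm (Fin n)) (k : Fin n) :
    listInv q (tailList τ k) =
      colCoeff q (tailList τ k).toFinset (τ k) * listInv q (tailList τ (k + 1)) := by
  rw [← colCoeff_erase_of_le q _ le_rfl, erase_toFinset_tailList, tailList_eq_cons τ k, listInv]

/-- The principal quantum minor of the rows and columns from `k` on. -/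
noncomputable def principalMinor (p q : Fin n → Fin n → ℂ) (u : ℂ) (k : ℕ) : QMat p q u :=
  minor q (entries p q u) (tailList 1 k) (tailList 1 k).toFinset

/-- Replace the first row by the eliminated combination of rows. The added rows already occur
further down and contribute nothing, while the new first row has the single entry `y` within the
columns of the minor. -/
theorem map_principalMinor (h : IsParameter p q u) {A : Type*} [Ring A] [Algebra ℂ A]
    (φ : QMat p q u →ₐ[ℂ] A) (k : Fin n) {y : A} {w : Fin n → A} (hw1 : w k = 1)
    (hw : ∀ j, k ≤ j →
      ∑ i with k ≤ i, w i * φ (genMatrix p q u i j) = if j = k then y else 0) :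
    φ (principalMinor p q u k) = y * φ (principalMinor p q u (k + 1)) := by
  set r := tailList (1 : Equiv.Perm (Fin n)) (k + 1) with hr
  set C := (tailList (1 : Equiv.Perm (Fin n)) k).toFinset with hC
  have hmemC : ∀ j, j ∈ C ↔ k ≤ j := fun j => by
    rw [hC, List.mem_toFinset, mem_tailList_one, Fin.le_def]
  have hrow : ∑ i with k ≤ i, w i * φ (minor q (entries p q u) (i :: r) C) =
      φ (principalMinor p q u k) := by
    rw [Finset.sum_eq_single k]
    · rw [hw1, one_mul, principalMinor, ← hC, tailList_eq_cons 1 k, Equiv.Perm.one_apply]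
    · intro i hi hik
      simp only [Finset.mem_filter, Finset.mem_univ, true_and] at hi
      rw [(isAlternating_genMatrix h).minor_cons_of_mem, map_zero, mul_zero]
      rw [hr, mem_tailList_one]
      exact lt_of_le_of_ne hi (fun h => hik h.symm)
    · simp
  have hcoeff : colCoeff q C k = 1 := by
    rw [colCoeff, Finset.filter_false_of_mem, Finset.prod_empty]
    intro j hj
    exact not_lt.2 ((hmemC j).1 hj)
  have herase : C.erase k = r.toFinset := erase_toFinset_tailList 1 k
  rw [← hrow]
  have hexp : ∀ i, w i * φ (minor q (entries p q u) (i :: r) C) =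
      ∑ j ∈ C, colCoeff q C j • (w i * φ (genMatrix p q u i j) *
        φ (minor q (entries p q u) r (C.erase j))) := by
    intro i
    rw [minor_cons, map_sum, Finset.mul_sum]
    exact Finset.sum_congr rfl fun j _ => by
      rw [map_smul, map_mul, mul_smul_comm, mul_assoc]
  simp only [hexp]
  rw [Finset.sum_comm, Finset.sum_eq_single k]
  · rw [← Finset.smul_sum, ← Finset.sum_mul, hw k le_rfl, if_pos rfl, hcoeff, one_smul, herase]
    rfl
  · intro j hj hjk
    rw [← Finset.smul_sum, ← Finset.sum_mul, hw j ((hmemC j).1 hj), if_neg hjk, zero_mul, smul_zero]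
  · intro hk
    exact absurd ((hmemC k).2 le_rfl) hk

/-- Under the faithful representation the principal minors are products of the commuting diagonal
operators `y m`. -/
theorem commute_principalMinor (h : IsParameter p q u) {k l : ℕ} (hk : k ≤ n) (hl : l ≤ n) :
    Commute (principalMinor p q u k) (principalMinor p q u l) := by
  obtain ⟨φ, y, hφ, hy, hw⟩ := exists_representation h
  have key : ∀ z, (∀ m, Commute z (y m)) → ∀ d k, k + d = n →
      Commute z (φ (principalMinor p q u k)) := by
    intro z hz d
    induction d with
    | zero =>
      intro k hk
      obtain rfl : k = n := by omega
      rw [principalMinor, tailList_self, minor_nil, map_one]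
      exact Commute.one_right z
    | succ d ih =>
      intro k hk
      obtain ⟨w, hw1, hw'⟩ := hw ⟨k, by omega⟩
      have := map_principalMinor h φ (⟨k, by omega⟩ : Fin n) (w := w) hw1 hw'
      simp only at this
      rw [this]
      exact (hz _).mul_right (ih (k + 1) (by omega))
  refine representation_injective h hφ ?_
  rw [map_mul, map_mul]
  exact key _ (fun m => (key _ (hy m) (n - k) k (by omega)).symm) (n - l) l (by omega)

theorem listInv_ofFn {m : ℕ} (b : Fin n → Fin n → ℂ) {f : Fin m → Fin n}
    (hf : Function.Injective f) : listInv b (List.ofFn f) =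
      ∏ x : Fin m × Fin m, if x.1 < x.2 ∧ f x.2 < f x.1 then -b (f x.2) (f x.1) else 1 := by
  induction m with
  | zero => simp [listInv]
  | succ m ih =>
    have hf' : Function.Injective fun i : Fin m => f i.succ :=
      hf.comp (Fin.succ_injective m)
    rw [List.ofFn_succ, listInv, ih hf', Fintype.prod_prod_type, Fintype.prod_prod_type,
      Fin.prod_univ_succ]
    congr 1
    · rw [Fin.prod_univ_succ, colCoeff]
      have himg : (List.ofFn fun i : Fin m => f i.succ).toFinset =
          Finset.univ.image fun i : Fin m => f i.succ := by
        ext i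
        simp [List.mem_ofFn]
      rw [himg, Finset.prod_filter, Finset.prod_image hf'.injOn]
      simp
    · refine Finset.prod_congr rfl fun i _ => ?_
      rw [Fin.prod_univ_succ]
      simp

theorem qInv_eq_listInv (σ : Equiv.Perm (Fin n)) : qInv q σ = listInv q (List.ofFn σ) := by
  rw [listInv_ofFn q σ.injective, qInv, ← Finset.prod_const, ← Finset.prod_mul_distrib,
    inversions, Finset.prod_filter]
  exact Finset.prod_congr rfl fun x _ => by simp

theorem qdet_eq_minor : qdet p q u =
    minor q (entries p q u) (List.ofFn (1 : Equiv.Perm (Fin n))) Finset.univ := by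
  rw [minor_eq_sum q _ _ _ (Finset.univ.image fun σ : Equiv.Perm (Fin n) => List.ofFn σ)]
  · rw [Finset.sum_image]
    · refine Finset.sum_congr rfl fun σ _ => ?_
      rw [qInv_eq_listInv]
      congr 2
      refine List.ext_getElem (by simp) fun i h1 h2 => ?_
      simp
    · intro σ _ τ _ hστ
      exact DFunLike.coe_injective (List.ofFn_injective hστ)
  · intro L
    simp only [Finset.mem_image, Finset.mem_univ, true_and]
    constructor
    · rintro ⟨σ, rfl⟩
      refine ⟨List.nodup_ofFn.2 σ.injective, ?_⟩
      ext i
      simp only [List.mem_toFinset, List.mem_ofFn, Finset.mem_univ, iff_true]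
      exact σ.surjective i
    · rintro ⟨h1, h2⟩
      have hlen : L.length = n := by
        rw [← List.toFinset_card_of_nodup h1, h2, Finset.card_univ, Fintype.card_fin]
      have hinj : Function.Injective fun i : Fin n => L.get (i.cast hlen.symm) :=
        (List.nodup_iff_injective_get.1 h1).comp (Fin.cast_injective _)
      refine ⟨Equiv.ofBijective _ (Finite.injective_iff_bijective.1 hinj), ?_⟩
      exact List.ext_getElem (by simp [hlen]) fun i h1 h2 => by simp
  · simp

/-- Sorting the rows costs the same inversion scalar as the columns do in `qdet`, because the row
and column parameters are both `q`. -/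
theorem qdet_eq_smul_minor (h : IsParameter p q u) (σ : Equiv.Perm (Fin n)) :
    minor q (entries p q u) (List.ofFn σ) Finset.univ = qInv q σ • qdet p q u := by
  rw [(isAlternating_genMatrix h).minor_insertionSort (List.nodup_ofFn.2 σ.injective),
    qInv_eq_listInv, qdet_eq_minor]
  congr 2
  refine List.Perm.eq_of_pairwise (le := (· ≤ ·)) (fun a b _ _ h1 h2 => le_antisymm h1 h2)
    (List.pairwise_insertionSort _ _) ?_ ((List.perm_insertionSort _ _).trans ?_)
  · rw [List.pairwise_ofFn]
    exact fun i j hij => hij.le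
  · rw [List.perm_ext_iff_of_nodup (List.nodup_ofFn.2 σ.injective)
      (List.nodup_ofFn.2 (Equiv.injective (1 : Equiv.Perm (Fin n))))]
    intro a
    simp [List.mem_ofFn, σ.surjective a]

end Tail

/-! ### Cramer's rule and the factorisation of the determinant. -/

section Quasideterminant

variable {n : ℕ} {K : Type*} [DivisionRing K] [Algebra ℂ K]

/-- Quasideterminants of a submatrix as ratios of quantum minors. -/
theorem hasQuasidet_of_minor {a b : Fin n → Fin n → ℂ} (ha : ∀ i j, a i j ≠ 0)
    (hb : ∀ i j, b i j ≠ 0) {X : Matrix (Fin n) (Fin n) K}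
    (hX : IsAlternating a b fun i j => X i j)
    {P Q : Fin n → Prop} [DecidablePred P] [DecidablePred Q] {i₀ j₀ : Fin n} {r : List (Fin n)}
    {C : Finset (Fin n)} (hr : (i₀ :: r).Nodup) (hP : ∀ i, i ∈ i₀ :: r ↔ P i)
    (hQ : ∀ j, j ∈ C ↔ Q j) (hcard : C.card = (i₀ :: r).length) (hi₀ : P i₀) (hj₀ : Q j₀)
    (hD : minor b (fun i j => X i j) (i₀ :: r) C ≠ 0)
    (hD' : minor b (fun i j => X i j) r (C.erase j₀) ≠ 0) :
    HasQuasidet (X.submatrix (Subtype.val : {i // P i} → Fin n) (Subtype.val : {j // Q j} → Fin n))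
      ⟨i₀, hi₀⟩ ⟨j₀, hj₀⟩
      ((colCoeff b C j₀)⁻¹ • (minor b (fun i j => X i j) (i₀ :: r) C *
        (minor b (fun i j => X i j) r (C.erase j₀))⁻¹)) := by
  set x : Fin n → Fin n → K := fun i j => X i j with hx
  set D := minor b x (i₀ :: r) C with hDdef
  have hex : ∀ i : {i // P i}, ∃ c : ℂ, c ≠ 0 ∧
      ∀ C, minor b x (i :: (i₀ :: r).erase i) C = c • minor b x (i₀ :: r) C := fun i =>
    hX.minor_cons_erase ha ((hP i).2 i.2)
  choose c hc0 hc using hex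
  have hβ : ∀ j, colCoeff b C j ≠ 0 := colCoeff_ne_zero hb C
  -- The cofactor matrix: `c i` compensates for moving row `i` to the front. Off the diagonal of the
  -- product, the expansion gives a minor with a repeated row.
  set Y : Matrix {j // Q j} {i // P i} K := Matrix.of fun j i =>
    ((c i)⁻¹ * colCoeff b C j) • (minor b x ((i₀ :: r).erase i) (C.erase j) * D⁻¹) with hY
  have hXY : X.submatrix (Subtype.val : {i // P i} → Fin n)
      (Subtype.val : {j // Q j} → Fin n) * Y = 1 := by
    ext i' i
    rw [Matrix.mul_apply]
    have hsum : ∑ j : {j // Q j}, X.submatrix (Subtype.val : {i // P i} → Fin n)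
        (Subtype.val : {j // Q j} → Fin n) i' j * Y j i =
          (c i)⁻¹ • (minor b x (i' :: (i₀ :: r).erase i) C * D⁻¹) := by
      rw [minor_cons, Finset.sum_mul, Finset.smul_sum, Finset.sum_subtype C hQ]
      refine Finset.sum_congr rfl fun j _ => ?_
      simp only [hY, Matrix.of_apply, Matrix.submatrix_apply, mul_smul_comm, smul_mul_assoc,
        smul_smul, mul_assoc, hx]
    rw [hsum]
    by_cases hii : i' = i
    · subst hii
      rw [hc, smul_mul_assoc, mul_inv_cancel₀ hD, smul_smul, inv_mul_cancel₀ (hc0 i'), one_smul,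
        Matrix.one_apply_eq]
    · have hmem : (i' : Fin n) ∈ (i₀ :: r).erase i :=
        (List.mem_erase_of_ne fun h => hii (Subtype.ext h)).2 ((hP i').2 i'.2)
      rw [hX.minor_cons_of_mem hmem, zero_mul, smul_zero, Matrix.one_apply_ne hii]
  have hc₀ : c ⟨i₀, hi₀⟩ = 1 := by
    have h1 := hc ⟨i₀, hi₀⟩ C
    simp only [List.erase_cons_head] at h1
    rw [← hDdef, eq_comm, ← sub_eq_zero, ← one_smul ℂ D, smul_smul, ← sub_smul, mul_one] at h1
    exact sub_eq_zero.1 ((smul_eq_zero.1 h1).resolve_right hD)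
  -- Over a division ring a one-sided inverse of a square matrix is two-sided; only equality of the
  -- numbers of rows and columns has to be checked.
  have hYX : Y * X.submatrix (Subtype.val : {i // P i} → Fin n)
      (Subtype.val : {j // Q j} → Fin n) = 1 := by
    refine (Matrix.mul_eq_one_comm_of_card_eq _ _ _ ?_).1 hXY
    rw [Fintype.card_of_subtype (i₀ :: r).toFinset (fun i => by rw [List.mem_toFinset, hP]),
      Fintype.card_of_subtype C hQ, List.toFinset_card_of_nodup hr, hcard]
  have hYval : Y ⟨j₀, hj₀⟩ ⟨i₀, hi₀⟩ =
      colCoeff b C j₀ • (minor b x r (C.erase j₀) * D⁻¹) := by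
    simp only [hY, Matrix.of_apply, hc₀, inv_one, one_mul, List.erase_cons_head]
  refine ⟨Y, hXY, hYX, ?_, ?_⟩
  · rw [hYval, smul_mul_smul_comm, inv_mul_cancel₀ (hβ j₀), one_smul, mul_assoc,
      inv_mul_cancel_left₀ hD', mul_inv_cancel₀ hD]
  · rw [hYval, smul_mul_smul_comm, mul_inv_cancel₀ (hβ j₀), one_smul, mul_assoc,
      inv_mul_cancel_left₀ hD, mul_inv_cancel₀ hD']

theorem prod_ofFn_telescope (F : ℕ → K) (m : ℕ) (hF : ∀ k ≤ m, F k ≠ 0) :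
    (List.ofFn fun k : Fin m => F k * (F (k + 1))⁻¹).prod = F 0 * (F m)⁻¹ := by
  induction m with
  | zero => simp [hF 0 le_rfl]
  | succ m ih =>
    rw [List.ofFn_succ', List.concat_eq_append, List.prod_append, List.prod_singleton]
    have := ih fun k hk => hF k (by omega)
    simp only [Fin.val_castSucc, Fin.val_last]
    rw [this, mul_assoc, inv_mul_cancel_left₀ (hF m (by omega))]

variable {p q : Fin n → Fin n → ℂ} {u : ℂ}

/-- The image in `K` of the quantum minor of the rows `σ m` and the columns `τ m`, `k ≤ m`,
normalised by the inversions of the columns. -/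
noncomputable def tailMinor (f : QMat p q u →ₐ[ℂ] K) (σ τ : Equiv.Perm (Fin n)) (k : ℕ) : K :=
  (listInv q (tailList τ k))⁻¹ •
    f (minor q (entries p q u) (tailList σ k) (tailList τ k).toFinset)

theorem tailMinor_ne_zero (h : IsParameter p q u) {f : QMat p q u →ₐ[ℂ] K}
    (hf : Function.Injective f) (σ τ : Equiv.Perm (Fin n)) (k : ℕ) : tailMinor f σ τ k ≠ 0 := by
  refine smul_ne_zero (inv_ne_zero (listInv_ne_zero h.q_ne_zero _)) ?_
  rw [Ne, map_eq_zero_iff f hf]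
  exact minor_ne_zero h (nodup_tailList σ k) (card_toFinset_tailList σ τ k)

theorem tailMinor_self (f : QMat p q u →ₐ[ℂ] K) (σ τ : Equiv.Perm (Fin n)) :
    tailMinor f σ τ n = 1 := by
  rw [tailMinor, tailList_self, tailList_self, minor_nil, map_one, listInv, inv_one, one_smul]

theorem hasQuasidet_tailMinor (h : IsParameter p q u) {f : QMat p q u →ₐ[ℂ] K}
    (hf : Function.Injective f) (σ τ : Equiv.Perm (Fin n)) (k : Fin n) :
    HasQuasidet (deleted ((genMatrix p q u).map f) σ τ k) (pivot σ k) (pivot τ k)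
      (tailMinor f σ τ k * (tailMinor f σ τ (k + 1))⁻¹) := by
  have hX := (isAlternating_genMatrix h).map f
  have hne : ∀ m, minor q (fun i j => f (entries p q u i j)) (tailList σ m)
      (tailList τ m).toFinset ≠ 0 := by
    intro m
    rw [← map_minor, Ne, map_eq_zero_iff f hf]
    exact minor_ne_zero h (nodup_tailList σ m) (card_toFinset_tailList σ τ m)
  have hnodup := nodup_tailList σ k
  have hcard := card_toFinset_tailList σ τ k
  have h0 := hne k
  have h1 := hne (k + 1)
  have hmem := mem_tailList σ k
  rw [← erase_toFinset_tailList] at h1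
  rw [tailList_eq_cons σ k] at hnodup hcard h0 hmem
  have key := hasQuasidet_of_minor (X := (genMatrix p q u).map f) (j₀ := τ k)
    (P := fun i => ∀ m, m < k → i ≠ σ m) (Q := fun i => ∀ m, m < k → i ≠ τ m)
    (C := (tailList τ k).toFinset) h.q_ne_zero h.q_ne_zero hX hnodup hmem
    (fun j => by rw [List.mem_toFinset]; exact mem_tailList τ k j) hcard (pivot σ k).2
    (pivot τ k).2 h0 h1
  have hβ := colCoeff_ne_zero h.q_ne_zero (tailList τ k).toFinset (τ k)
  have hL := listInv_ne_zero h.q_ne_zero (tailList τ (k + 1))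
  have hm := map_minor f q (entries p q u)
  -- The normalisation by `listInv` is chosen so that consecutive scalars have ratio `colCoeff`, the
  -- coefficient in the quasideterminant; the scalars then telescope together with the minors.
  have hval : tailMinor f σ τ k * (tailMinor f σ τ (k + 1))⁻¹ =
      (colCoeff q (tailList τ k).toFinset (τ k))⁻¹ •
        (minor q (fun i j => f (entries p q u i j)) (σ k :: tailList σ (k + 1))
          (tailList τ k).toFinset * (minor q (fun i j => f (entries p q u i j))
            (tailList σ (k + 1)) ((tailList τ k).toFinset.erase (τ k)))⁻¹) := by
    rw [tailMinor, tailMinor, listInv_tailList, ← tailList_eq_cons, erase_toFinset_tailList,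
      smul_inv₀, smul_mul_smul_comm, inv_inv, hm, hm]
    congr 1
    field_simp
  rw [hval]
  exact key

/-- The product telescopes to the full minor with rows in the order `σ`, divided by `qInv q τ`;
sorting the rows contributes `qInv q σ`. -/
theorem prod_tailMinor (h : IsParameter p q u) {f : QMat p q u →ₐ[ℂ] K}
    (hf : Function.Injective f) (σ τ : Equiv.Perm (Fin n)) :
    f (qdet p q u) = (qInv q τ / qInv q σ) •
      (List.ofFn fun k : Fin n => tailMinor f σ τ k * (tailMinor f σ τ (k + 1))⁻¹).prod := by
  rw [prod_ofFn_telescope (tailMinor f σ τ) n fun k _ => tailMinor_ne_zero h hf σ τ k,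
    tailMinor_self, inv_one, mul_one, tailMinor]
  have huniv : (tailList τ 0).toFinset = Finset.univ := by
    ext i
    simp [mem_tailList]
  have hσ : qInv q σ ≠ 0 := by
    rw [qInv_eq_listInv]
    exact listInv_ne_zero h.q_ne_zero _
  have hτ : qInv q τ ≠ 0 := by
    rw [qInv_eq_listInv]
    exact listInv_ne_zero h.q_ne_zero _
  rw [huniv, tailList, tailList, List.drop_zero, List.drop_zero, qdet_eq_smul_minor h,
    ← qInv_eq_listInv, map_smul, smul_smul, smul_smul]
  rw [show qInv q τ / qInv q σ * (qInv q τ)⁻¹ * qInv q σ = 1 by field_simp, one_smul]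

theorem tailMinor_last (f : QMat p q u →ₐ[ℂ] K) (σ τ : Equiv.Perm (Fin n)) (k : Fin n)
    (hk : (k : ℕ) + 1 = n) :
    tailMinor f σ τ k * (tailMinor f σ τ (k + 1))⁻¹ = f (genMatrix p q u (σ k) (τ k)) := by
  rw [hk, tailMinor_self, inv_one, mul_one, tailMinor, tailList_eq_cons, tailList_eq_cons, hk,
    tailList_self, tailList_self]
  simp [listInv, minor_cons, minor_nil, colCoeff, Finset.filter_singleton]

theorem commute_tailMinor (h : IsParameter p q u) (f : QMat p q u →ₐ[ℂ] K) {k l : ℕ} (hk : k ≤ n)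
    (hl : l ≤ n) : Commute (tailMinor f 1 1 k) (tailMinor f 1 1 l) :=
  (((commute_principalMinor h hk hl).map f).smul_left _).smul_right _

end Quasideterminant

end QuantumMatrix

theorem theorem3p2 (n : ℕ) (p q : Fin n → Fin n → ℂ) (u : ℂ)
    (h : QuantumMatrix.IsParameter p q u) :
    -- the ring of fractions of `M_{p,u}(n)` exists and is a division ring
    IsDomain (QuantumMatrix.QMat p q u) ∧
    Nonempty (OreLocalization.OreSet (QuantumMatrix.QMat p q u)⁰) ∧
    -- identities in the ring of fractions
    ∀ [OreLocalization.OreSet (QuantumMatrix.QMat p q u)⁰],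
      (∃ d : Fin n → OreLocalization (QuantumMatrix.QMat p q u)⁰ (QuantumMatrix.QMat p q u),
        (∀ k, QuantumMatrix.HasQuasidet
          (QuantumMatrix.deleted ((QuantumMatrix.genMatrix p q u).map
            (QuantumMatrix.toFrac p q u)) 1 1 k)
          (QuantumMatrix.pivot 1 k) (QuantumMatrix.pivot 1 k) (d k)) ∧
        QuantumMatrix.toFrac p q u (QuantumMatrix.qdet p q u) = (List.ofFn d).prod ∧
        (∀ k : Fin n, (k : ℕ) + 1 = n →
          d k = QuantumMatrix.toFrac p q u (QuantumMatrix.genMatrix p q u k k)) ∧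
        ∀ k l, Commute (d k) (d l)) ∧
      ∀ σ τ : Equiv.Perm (Fin n),
        ∃ d : Fin n → OreLocalization (QuantumMatrix.QMat p q u)⁰ (QuantumMatrix.QMat p q u),
          (∀ k, QuantumMatrix.HasQuasidet
            (QuantumMatrix.deleted ((QuantumMatrix.genMatrix p q u).map
              (QuantumMatrix.toFrac p q u)) σ τ k)
            (QuantumMatrix.pivot σ k) (QuantumMatrix.pivot τ k) (d k)) ∧
          QuantumMatrix.toFrac p q u (QuantumMatrix.qdet p q u) =
            (QuantumMatrix.qInv q τ / QuantumMatrix.qInv q σ) • (List.ofFn d).prod ∧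
          ∀ k : Fin n, (k : ℕ) + 1 = n →
            d k = QuantumMatrix.toFrac p q u (QuantumMatrix.genMatrix p q u (σ k) (τ k)) := by
  have hdom := QuantumMatrix.isDomain_qMat h
  refine ⟨hdom, QuantumMatrix.nonempty_oreSet_qMat h, ?_⟩
  intro hore
  let f : QuantumMatrix.QMat p q u →ₐ[ℂ]
      OreLocalization (QuantumMatrix.QMat p q u)⁰ (QuantumMatrix.QMat p q u) :=
    { QuantumMatrix.toFrac p q u with commutes' := fun _ => rfl }
  have hf : Function.Injective f :=
    OreLocalization.numeratorHom_inj inf_le_left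
  have hone : QuantumMatrix.qInv q 1 ≠ 0 := by
    rw [QuantumMatrix.qInv_eq_listInv]
    exact QuantumMatrix.listInv_ne_zero h.q_ne_zero _
  refine ⟨⟨fun k => QuantumMatrix.tailMinor f 1 1 k * (QuantumMatrix.tailMinor f 1 1 (k + 1))⁻¹,
    QuantumMatrix.hasQuasidet_tailMinor h hf 1 1, ?_, QuantumMatrix.tailMinor_last f 1 1, ?_⟩,
    fun σ τ => ⟨fun k => QuantumMatrix.tailMinor f σ τ k *
      (QuantumMatrix.tailMinor f σ τ (k + 1))⁻¹, QuantumMatrix.hasQuasidet_tailMinor h hf σ τ,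
      QuantumMatrix.prod_tailMinor h hf σ τ, QuantumMatrix.tailMinor_last f σ τ⟩⟩
  · have := QuantumMatrix.prod_tailMinor h hf 1 1
    rwa [div_self hone, one_smul] at this
  · intro k l
    have hc : ∀ {a b : ℕ}, a ≤ n → b ≤ n → Commute (QuantumMatrix.tailMinor f 1 1 a)
        (QuantumMatrix.tailMinor f 1 1 b) := QuantumMatrix.commute_tailMinor h f
    have hk := k.2
    have hl := l.2
    exact ((hc (by omega) (by omega)).mul_right (hc (by omega) (by omega)).inv_right₀).mul_left
      ((hc (by omega) (by omega)).mul_right (hc (by omega) (by omega)).inv_right₀).inv_left₀
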